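/- Consider agents $\mathcal V=\{1,\dots,N\}$ and, for every time $k\ge 0$, a (deterministic) undirected graph $\mathcal G(k)=(\mathcal V,\mathcal E(k))$ without self-loops and a set $\mathcal B(k)\subseteq\mathcal V$ of failed agents; a failed agent is isolated in $\mathcal G(k)$. (Link failures at time $k$ are links missing in $\mathcal E(k)$.) Let $\rho>0$, $u\in\mathbb C$ with $|u|=1$, $p_i\in(0,1)$, $\sigma_i\ge 0$, $\Lambda_{ij}=\Lambda_{ji}\ge 0$ with $\Lambda_{ij}>0$ whenever $(i,j)$ is an edge of some $\mathcal G(k)$, step sizes $\alpha(k)>0$, and deterministic initial states $x_i(0)\ge 0$. On a probability space let all the random variables $\gamma_i(k)\in\{0,1\}$ with $\mathbb P(\gamma_i(k)=1)=p_i$, $h_{ij}(k)\sim\mathcal{CN}(0,\Lambda_{ij})$ and $n_i(k)\sim\mathcal{CN}(0,\sigma_i^2)$ ($i,j\in\mathcal V$, $k\ge0$) be mutually independent, where $\mathcal{CN}(0,v)$ is the law of a complex variable with independent real and imaginary parts distributed as $N(0,v/2)$. Put $\Gamma_{ij}(k)=\gamma_i(k)(1-\gamma_j(k))+\gamma_j(k)(1-\gamma_i(k))$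 and $$\bar a_{ij}(k)=\begin{cases}\rho\,(p_i(1-p_j)+p_j(1-p_i))\,\Lambda_{ij},&(i,j)\in\mathcal E(k),\\ 0,&\text{otherwise.}\end{cases}$$ At time $k$ agent $j$ transmits $s_j(k)=\sqrt{\rho x_j(k)}\,u$, agent $i$ receives $$y_i(k)=\sum_{j:(i,j)\in\mathcal E(k)}\Gamma_{ij}(k)h_{ij}(k)s_j(k)+n_i(k),$$ and the states are updated by $x_i(k+1)=x_i(k)$ if $i\in\mathcal B(k)$, and otherwise by $$x_i(k+1)=\Bigl(1-\alpha(k)\sum_{j\in\mathcal V}\bar a_{ij}(k)\Bigr)x_i(k)+\alpha(k)\bigl(|y_i(k)|^2-\sigma_i^2\bigr).$$ (Noise can make a state negative. For $t<0$, $\sqrt t$ may be any fixed measurable convention with values in $\mathbb C$ and $|\sqrt t|^2\le|t|$, e.g. $\sqrt t=\mathrm i\sqrt{|t|}$, or $\sqrt t=0$.) Assume: 1. $\sum_k\alpha(k)=\infty$, $\sum_k\alpha(k)^2<\infty$, and $1-\alpha(k)\sum_{j}\bar a_{ij}(k)>0$ for all $i\in\mathcal V$, $k\ge0$; 2. there is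 an integer $L>0$ such that for every $k\ge0$ the joint graph $\mathcal G(k)\cup\mathcal G(k+1)\cup\dots\cup\mathcal G(k+L-1)$ is connected; 3. $\alpha(k+1)\le\alpha(k)$ for all $k\ge0$, and $\limsup_{k\to\infty}\alpha(k)/\alpha(k+1)<\infty$. Let $V(k)=\|(I_N-J)\boldsymbol x(k)\|^2$ with $\boldsymbol x(k)=(x_1(k),\dots,x_N(k))^T$, $J=\frac1N\mathbf 1_N\mathbf 1_N^T$ and the Euclidean norm. Then $V(k)$ is integrable for every $k$, and $$\lim_{k\to\infty}\mathbb E[V(k)]=0 .$$ -/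

import Mathlib

open MeasureTheory ProbabilityTheory Filter Topology
open scoped NNReal ENNReal

noncomputable section

/-- The circularly symmetric complex Gaussian law `CN(0, v)`: real and imaginary part are
independent centred real Gaussians of variance `v / 2` each. -/
def complexGaussian (v : ℝ≥0) : Measure ℂ :=
  ((gaussianReal 0 (v / 2)).prod (gaussianReal 0 (v / 2))).map Complex.measurableEquivRealProd.symm

/-- The deterministic data of a multi-agent system with agents `Fin N` which communicate by
over-the-air aggregation on a time-varying network. -/
structure AirSystem (N : ℕ) where
  /-- the undirected network topology at time `k` -/
  graph : ℕ → SimpleGraph (Fin N)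
  /-- the agents that suffer from node failure at time `k` -/
  failed : ℕ → Set (Fin N)
  /-- a failed agent cannot communicate with any agent -/
  not_adj_of_failed : ∀ k i, i ∈ failed k → ∀ j, ¬ (graph k).Adj i j
  /-- the probability with which agent `i` transmits in the first time slot -/
  p : Fin N → ℝ
  p_mem : ∀ i, p i ∈ Set.Ioo (0 : ℝ) 1
  /-- the variance of the fading channel from agent `j` to agent `i` -/
  Lam : Fin N → Fin N → ℝ≥0
  Lam_symm : ∀ i j, Lam i j = Lam j i
  /-- the channel over a link of the network does not vanish -/
  Lam_pos : ∀ k i j, (graph k).Adj i j → 0 < Lam i j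
  /-- the standard deviation of the noise at agent `i` -/
  σ : Fin N → ℝ≥0
  /-- the transmission coefficient -/
  ρ : ℝ
  ρ_pos : 0 < ρ
  /-- the carrier wave -/
  u : ℂ
  norm_u : ‖u‖ = 1
  /-- the step sizes -/
  α : ℕ → ℝ
  α_pos : ∀ k, 0 < α k
  /-- the initial information states -/
  x₀ : Fin N → ℝ
  x₀_nonneg : ∀ i, 0 ≤ x₀ i
  /-- The square root used for power control. It is the usual one on `[0, ∞)`. Noise may push a
  state below `0`; what is sent then is left open, except that the square root of `t < 0` has
  modulus at most `√|t|` (for example `i √|t|`, or `0` if the agent is then silent). -/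
  root : ℝ → ℂ
  root_measurable : Measurable root
  root_of_nonneg : ∀ t, 0 ≤ t → root t = (Real.sqrt t : ℂ)
  root_of_neg : ∀ t, t < 0 → ‖root t‖ ^ 2 ≤ |t|

/-- The random inputs of the system: slot selections `γ`, fading `h` and receiver noise `n`,
all mutually independent over agents and times. -/
structure AirRandomness {N : ℕ} (S : AirSystem N) {Ω : Type*} [MeasurableSpace Ω]
    (μ : Measure Ω) where
  /-- `γ i k = 1` if agent `i` transmits in the first slot of time step `k`, else `γ i k = 0` -/
  γ : Fin N → ℕ → Ω → ℝ
  /-- `h i j k` is the fading from agent `j` to agent `i` at time `k` -/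
  h : Fin N → Fin N → ℕ → Ω → ℂ
  /-- `n i k` is the noise at agent `i` at time `k` -/
  n : Fin N → ℕ → Ω → ℂ
  γ_measurable : ∀ i k, Measurable (γ i k)
  h_measurable : ∀ i j k, Measurable (h i j k)
  n_measurable : ∀ i k, Measurable (n i k)
  γ_values : ∀ i k ω, γ i k ω = 0 ∨ γ i k ω = 1
  γ_law : ∀ i k, μ {ω | γ i k ω = 1} = ENNReal.ofReal (S.p i)
  h_law : ∀ i j k, μ.map (h i j k) = complexGaussian (S.Lam i j)
  n_law : ∀ i k, μ.map (n i k) = complexGaussian (S.σ i ^ 2)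
  indep : iIndepFun
    (Sum.elim (fun q : Fin N × ℕ => fun ω => ((γ q.1 q.2 ω : ℝ) : ℂ))
      (Sum.elim (fun q : Fin N × Fin N × ℕ => h q.1 q.2.1 q.2.2)
        (fun q : Fin N × ℕ => n q.1 q.2))) μ

namespace AirSystem

variable {N : ℕ} (S : AirSystem N)

open Classical in
/-- The mean weight `ā_ij(k)`. -/
def abar (k : ℕ) (i j : Fin N) : ℝ :=
  if (S.graph k).Adj i j then
    S.ρ * (S.p i * (1 - S.p j) + S.p j * (1 - S.p i)) * (S.Lam i j : ℝ)
  else 0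

/-- The signal that encodes the state `t`. -/
def signal (t : ℝ) : ℂ := S.root (S.ρ * t) * S.u

/-- Step size conditions: `∑ α(k) = ∞`, `∑ α(k)² < ∞`, and
`1 - α(k) ∑_j ā_ij(k) > 0` for all `i` and `k`. -/
def StepSize : Prop :=
  Tendsto (fun K => ∑ k ∈ Finset.range K, S.α k) atTop atTop ∧
  Summable (fun k => S.α k ^ 2) ∧
  ∀ i k, 0 < 1 - S.α k * ∑ j, S.abar k i j

/-- `L`-connectivity: the joint graph over every window of length `L` is connected. -/
def JointlyConnected : Prop :=
  ∃ L : ℕ, 0 < L ∧ ∀ k, (⨆ t ∈ Finset.range L, S.graph (k + t)).Connected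

/-- The step sizes are nonincreasing and `limsup α(k) / α(k+1) < ∞`. -/
def MonotoneStepSize : Prop :=
  (∀ k, S.α (k + 1) ≤ S.α k) ∧
  limsup (fun k => ((S.α k / S.α (k + 1) : ℝ) : EReal)) atTop < ⊤

end AirSystem

namespace AirRandomness

variable {N : ℕ} {S : AirSystem N} {Ω : Type*} [MeasurableSpace Ω] {μ : Measure Ω}
  (R : AirRandomness S μ)

/-- `Γ_ij(k)` is `1` if agents `i` and `j` select different slots, else `0`. -/
def Gam (k : ℕ) (i j : Fin N) (ω : Ω) : ℝ :=
  R.γ i k ω * (1 - R.γ j k ω) + R.γ j k ω * (1 - R.γ i k ω)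

open Classical in
/-- The signal received by agent `i` at time `k` if the states are `x`. -/
def received (k : ℕ) (x : Fin N → ℝ) (i : Fin N) (ω : Ω) : ℂ :=
  (∑ j with (S.graph k).Adj i j, (R.Gam k i j ω : ℂ) * R.h i j k ω * S.signal (x j)) + R.n i k ω

open Classical in
/-- The information states under the consensus protocol. A failed agent keeps its state. -/
def state : ℕ → Ω → Fin N → ℝ
  | 0, _, i => S.x₀ i
  | k + 1, ω, i =>
    if i ∈ S.failed k then state k ω i
    else (1 - S.α k * ∑ j, S.abar k i j) * state k ω i
      + S.α k * (‖R.received k (state k ω) i ω‖ ^ 2 - (S.σ i : ℝ) ^ 2)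

/-- The disagreement `V(k) = ‖(I - J) x(k)‖²` with `J = (1/N) 1 1ᵀ`. -/
def V (k : ℕ) (ω : Ω) : ℝ :=
  ‖WithLp.toLp 2 (Matrix.mulVec
    ((1 : Matrix (Fin N) (Fin N) ℝ) - (1 / (N : ℝ)) • Matrix.of (fun _ _ => (1 : ℝ)))
    (R.state k ω))‖ ^ 2

end AirRandomness

end

/-! Write the update as a stochastic approximation: state plus `α k` times `drive`. Fading has mean
zero and is independent across links, so the cross terms in the received power vanish in the mean.
Tested against any square-integrable function of the past, `drive` may therefore be replaced by
`drift` (`integral_mul_drive`). The drift is a weighted graph Laplacian, except that a negative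
state enters its neighbours' updates through its transmitted power.

For a function with a quadratic upper bound, the mean changes in one step by a drift term of order
`α k` and a remainder of order `α k ^ 2` (`integral_step_le`). This is used for three functions. For
`∑ x i ^ 2` the drift term is nonpositive because power is at most the modulus of the state, so
second moments stay bounded. For the squared negative parts the drift term is dissipative because
powers are nonnegative and only the decay of the agent's own state matters. For the squared
deviations the Laplacian dissipates, and the nonlinearity costs only negative parts, already known
to vanish in mean square.

No single graph need be connected, so dissipation can be guaranteed only over a window of length
`L`. There the state can be frozen at the start of the window, since it moves by `o(1)` in mean
square (`tendsto_integral_sum_sub_sq`). A Poincaré inequality on the joint graph, or a degree bound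
for the negative parts, then bounds the total dissipation below. The scalar lemma
`tendsto_zero_of_window_decrease` turns this into convergence. -/

/-! ### Scalar recursions -/

/-- A nonnegative sequence contracted by factors `1 - θ k` with divergent `∑ θ k`, up to
perturbations that are small relative to `θ k`, tends to `0`. -/
theorem tendsto_zero_of_contraction {W θ η : ℕ → ℝ} (hW : ∀ k, 0 ≤ W k)
    (hθ : ∀ k, 0 ≤ θ k) (hθ1 : ∀ᶠ k in atTop, θ k ≤ 1)
    (hsum : Tendsto (fun K => ∑ k ∈ Finset.range K, θ k) atTop atTop)
    (hη : Tendsto η atTop (𝓝 0))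
    (hrec : ∀ᶠ k in atTop, W (k + 1) ≤ (1 - θ k) * W k + θ k * η k) :
    Tendsto W atTop (𝓝 0) := by
  refine tendsto_order.2 ⟨fun a ha => Eventually.of_forall fun k => ha.trans_le (hW k), ?_⟩
  intro a ha
  have hη' : ∀ᶠ k in atTop, η k ≤ a / 2 := (hη.eventually_lt_const (by linarith)).mono
    fun _ h => h.le
  obtain ⟨K, hK⟩ := eventually_atTop.1 ((hθ1.and hη').and hrec)
  -- Only the excess over `a / 2` is contracted. The induction uses `θ ≤ 1` to multiply the previous
  -- bound by `1 - θ`, and then `1 - θ ≤ exp (-θ)`.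
  have key : ∀ n, W (K + n) ≤ a / 2
      + Real.exp ((∑ k ∈ Finset.range K, θ k) - ∑ k ∈ Finset.range (K + n), θ k) * W K := by
    intro n
    induction n with
    | zero => simp; linarith
    | succ n ih =>
      obtain ⟨⟨h1, h2⟩, h3⟩ := hK (K + n) (by omega)
      rw [← add_assoc, Finset.sum_range_succ, ← sub_sub]
      set E := (∑ k ∈ Finset.range K, θ k) - ∑ k ∈ Finset.range (K + n), θ k
      have h4 : (1 - θ (K + n)) * W (K + n) ≤ (1 - θ (K + n)) * (a / 2 + Real.exp E * W K) :=
        mul_le_mul_of_nonneg_left ih (by linarith)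
      have h5 : θ (K + n) * η (K + n) ≤ θ (K + n) * (a / 2) :=
        mul_le_mul_of_nonneg_left h2 (hθ _)
      have h6 : (1 - θ (K + n)) * (Real.exp E * W K)
          ≤ Real.exp (-θ (K + n)) * (Real.exp E * W K) :=
        mul_le_mul_of_nonneg_right (by linarith [Real.add_one_le_exp (-θ (K + n))])
          (mul_nonneg (Real.exp_pos _).le (hW _))
      rw [sub_eq_add_neg E, Real.exp_add]
      nlinarith
  have hlim : Tendsto (fun n => Real.exp ((∑ k ∈ Finset.range K, θ k)
      - ∑ k ∈ Finset.range (K + n), θ k) * W K) atTop (𝓝 0) := by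
    rw [← zero_mul (W K)]
    refine Tendsto.mul_const _ (Real.tendsto_exp_atBot.comp ?_)
    refine tendsto_atBot_add_const_left _ _ (tendsto_neg_atTop_atBot.comp ?_)
    exact hsum.comp (tendsto_add_atTop_nat K |>.congr fun n => add_comm _ _)
  obtain ⟨n₀, hn₀⟩ := eventually_atTop.1 (hlim.eventually_lt_const (show (0 : ℝ) < a / 2 by linarith))
  refine eventually_atTop.2 ⟨K + n₀, fun k hk => ?_⟩
  have h1 := key (k - K)
  have h2 := hn₀ (k - K) (by omega)
  rw [show K + (k - K) = k by omega] at h1 h2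
  linarith

theorem tendsto_zero_sum_window {η : ℕ → ℝ} (hη : Tendsto η atTop (𝓝 0)) (L : ℕ) :
    Tendsto (fun k => ∑ t ∈ Finset.range L, η (k + t)) atTop (𝓝 0) := by
  rw [← Finset.sum_const_zero (s := Finset.range L) (M := ℝ)]
  exact tendsto_finsetSum _ fun t _ => hη.comp (tendsto_add_atTop_nat t)

/-- A nonnegative sequence which decreases, up to small perturbations, at the rates `α k * e k`
tends to `0` if over windows of length `L` the `e k` dominate the sequence. -/
theorem tendsto_zero_of_window_decrease {α v e η ζ : ℕ → ℝ} {L : ℕ} {c M : ℝ}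
    (hα : ∀ k, 0 < α k) (hanti : Antitone α) (hα0 : Tendsto α atTop (𝓝 0))
    (hsum : Tendsto (fun K => ∑ k ∈ Finset.range K, α k) atTop atTop)
    (hM : ∀ᶠ k in atTop, α k ≤ M * α (k + 1))
    (hL : 0 < L) (hc : 0 < c) (hv : ∀ k, 0 ≤ v k) (he : ∀ k, 0 ≤ e k)
    (hη : Tendsto η atTop (𝓝 0)) (hζ : Tendsto ζ atTop (𝓝 0))
    (hrec : ∀ k, v (k + 1) ≤ v k - α k * e k + α k * η k)
    (hwin : ∀ k, c * v k - ζ k ≤ ∑ t ∈ Finset.range L, e (k + t)) :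
    Tendsto v atTop (𝓝 0) := by
  have hMpos : 0 < M := by
    obtain ⟨k, hk⟩ := hM.exists
    exact pos_of_mul_pos_left ((hα k).trans_le hk) (hα _).le
  have hM' : ∀ t, ∀ᶠ k in atTop, α k ≤ M ^ t * α (k + t) := by
    intro t
    induction t with
    | zero => simp
    | succ t ih =>
      filter_upwards [ih, (tendsto_add_atTop_nat t).eventually hM] with k h1 h2
      calc α k ≤ M ^ t * α (k + t) := h1
        _ ≤ M ^ t * (M * α (k + t + 1)) := by gcongr
        _ = M ^ (t + 1) * α (k + (t + 1)) := by ring_nf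
  have hηabs : Tendsto (fun k => |η k|) atTop (𝓝 0) := by simpa using hη.abs
  set κ : ℕ → ℝ := fun k => ∑ t ∈ Finset.range L, α (k + t) * |η (k + t)| with hκ
  have hκ0 : Tendsto κ atTop (𝓝 0) :=
    tendsto_zero_sum_window (η := fun k => α k * |η k|) (by simpa using hα0.mul hηabs) L
  set β : ℕ → ℝ := fun k => ∑ t ∈ Finset.range L, |η (k + t)| with hβ
  have hβ0 : Tendsto β atTop (𝓝 0) := tendsto_zero_sum_window hηabs L
  have hstep : ∀ k t, v (k + t) ≤ v k - ∑ s ∈ Finset.range t, α (k + s) * e (k + s)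
      + ∑ s ∈ Finset.range t, α (k + s) * |η (k + s)| := by
    intro k t
    induction t with
    | zero => simp
    | succ t ih =>
      rw [Finset.sum_range_succ, Finset.sum_range_succ, ← add_assoc]
      have h1 := hrec (k + t)
      have h2 := mul_le_mul_of_nonneg_left (le_abs_self (η (k + t))) (hα (k + t)).le
      linarith
  have hle : ∀ k, ∀ t ∈ Finset.range L, v (k + t) ≤ v k + κ k := by
    intro k t ht
    have h1 := hstep k t
    have h2 : 0 ≤ ∑ s ∈ Finset.range t, α (k + s) * e (k + s) :=
      Finset.sum_nonneg fun s _ => mul_nonneg (hα _).le (he _)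
    have h3 : ∑ s ∈ Finset.range t, α (k + s) * |η (k + s)| ≤ κ k :=
      Finset.sum_le_sum_of_subset_of_nonneg
        (Finset.range_mono (Finset.mem_range.1 ht).le)
        fun s _ _ => mul_nonneg (hα _).le (abs_nonneg _)
    linarith
  -- Only the drop from `v k` to `v (k + L)` is controlled, and this is exactly the one-step
  -- increment of the window sum `W`. As `W k` is at most `L * v k` up to a small error, `W`
  -- contracts at every step, without passing to blocks of times.
  set W : ℕ → ℝ := fun k => ∑ t ∈ Finset.range L, v (k + t) with hW
  have hLpos : (0 : ℝ) < L := by exact_mod_cast hL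
  have hWle : ∀ k, W k ≤ L * (v k + κ k) := by
    intro k
    simpa [W, mul_add] using Finset.sum_le_card_nsmul _ _ _ (hle k)
  have hWsucc : ∀ k, W (k + 1) = W k + v (k + L) - v k := by
    intro k
    have h1 := Finset.sum_range_succ (fun t => v (k + t)) L
    have h2 := Finset.sum_range_succ' (fun t => v (k + t)) L
    simp only [add_zero] at h2
    have h3 : W (k + 1) = ∑ t ∈ Finset.range L, v (k + (t + 1)) :=
      Finset.sum_congr rfl fun t _ => by ring_nf
    rw [h3]
    linarith
  have hWnn : ∀ k, 0 ≤ W k := fun k => Finset.sum_nonneg fun _ _ => hv _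
  have hvW : ∀ k, v k ≤ W k := fun k => by
    simpa using Finset.single_le_sum (f := fun t => v (k + t)) (fun t _ => hv _)
      (Finset.mem_range.2 hL)
  have hθ0 : Tendsto (fun k => α (k + L) * (c / L)) atTop (𝓝 0) := by
    simpa using (hα0.comp (tendsto_add_atTop_nat L)).mul_const (c / L)
  have hW0 : Tendsto W atTop (𝓝 0) := by
    refine tendsto_zero_of_contraction (θ := fun k => α (k + L) * (c / L))
      (η := fun k => (L / c) * (c * κ k + ζ k + M ^ L * β k)) hWnn
      (fun k => mul_nonneg (hα _).le (by positivity))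
      ((hθ0.eventually_lt_const one_pos).mono fun _ h => h.le) ?_ ?_ ?_
    · simp_rw [← Finset.sum_mul]
      refine Tendsto.atTop_mul_const (by positivity) ?_
      have := tendsto_atTop_add_const_right _ (-∑ k ∈ Finset.range L, α k)
        (hsum.comp (tendsto_add_atTop_nat L))
      refine this.congr fun K => ?_
      simp only [Function.comp]
      rw [add_comm K L, Finset.sum_range_add]
      simp_rw [add_comm L]
      ring
    · have := (((hκ0.const_mul c).add hζ).add (hβ0.const_mul (M ^ L))).const_mul (L / c)
      simpa using this
    · filter_upwards [hM' L] with k hk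
      have h1 := hstep k L
      have h2 : α (k + L) * (c * v k - ζ k)
          ≤ ∑ s ∈ Finset.range L, α (k + s) * e (k + s) := by
        refine (mul_le_mul_of_nonneg_left (hwin k) (hα _).le).trans ?_
        rw [Finset.mul_sum]
        exact Finset.sum_le_sum fun s hs => mul_le_mul_of_nonneg_right
          (hanti (by have := Finset.mem_range.1 hs; omega)) (he _)
      -- The decrease is guaranteed only at the smallest rate `α (k + L)`, while perturbations enter
      -- at rates up to `α k`; the bounded ratio of step sizes makes the two comparable.
      have h3 : ∑ s ∈ Finset.range L, α (k + s) * |η (k + s)| ≤ M ^ L * α (k + L) * β k := by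
        rw [hβ, Finset.mul_sum]
        exact Finset.sum_le_sum fun s _ => mul_le_mul_of_nonneg_right
          ((hanti (by omega)).trans hk) (abs_nonneg _)
      have h4 : α (k + L) * (c / L) * W k ≤ α (k + L) * (c / L) * (L * (v k + κ k)) :=
        mul_le_mul_of_nonneg_left (hWle k) (mul_nonneg (hα _).le (by positivity))
      have h5 : α (k + L) * (c / L) * (L * (v k + κ k)) = α (k + L) * c * (v k + κ k) := by
        field_simp
      have h6 : α (k + L) * (c / L) * ((L / c) * (c * κ k + ζ k + M ^ L * β k))
          = α (k + L) * (c * κ k + ζ k + M ^ L * β k) := by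
        field_simp
      rw [hWsucc, h6]
      rw [h5] at h4
      nlinarith
  exact squeeze_zero hv hvW hW0

/-- A nonnegative sequence with multiplicative and additive increments of summable size is
bounded. -/
theorem bounded_of_summable_growth {s a : ℕ → ℝ} (ha : ∀ k, 0 ≤ a k) (hsum : Summable a)
    (hs : ∀ k, 0 ≤ s k) (hrec : ∀ k, s (k + 1) ≤ s k + a k * (1 + s k)) :
    ∃ B, ∀ k, s k ≤ B := by
  have key : ∀ k, 1 + s k ≤ Real.exp (∑ t ∈ Finset.range k, a t) * (1 + s 0) := by
    intro k
    induction k with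
    | zero => simp
    | succ k ih =>
      rw [Finset.sum_range_succ, Real.exp_add]
      calc 1 + s (k + 1) ≤ (a k + 1) * (1 + s k) := by linarith [hrec k]
        _ ≤ Real.exp (a k) * (Real.exp (∑ t ∈ Finset.range k, a t) * (1 + s 0)) :=
          mul_le_mul (Real.add_one_le_exp _) ih (by linarith [hs k]) (Real.exp_pos _).le
        _ = _ := by ring
  refine ⟨Real.exp (∑' t, a t) * (1 + s 0), fun k => ?_⟩
  have h1 : Real.exp (∑ t ∈ Finset.range k, a t) ≤ Real.exp (∑' t, a t) :=
    Real.exp_le_exp.2 (hsum.sum_le_tsum _ fun _ _ => ha _)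
  have h2 := mul_le_mul_of_nonneg_right h1 (show 0 ≤ 1 + s 0 by linarith [hs 0])
  linarith [key k]

/-! ### Deviations from the average and weighted graphs -/

/-- The deviation of the `i`-th coordinate from the average. -/
noncomputable def deviation {N : ℕ} (x : Fin N → ℝ) (i : Fin N) : ℝ := x i - (∑ j, x j) / N

theorem sum_deviation {N : ℕ} (x : Fin N → ℝ) : ∑ i, deviation x i = 0 := by
  rcases Nat.eq_zero_or_pos N with rfl | hN
  · simp
  · have : (N : ℝ) ≠ 0 := by positivity
    simp [deviation, Finset.sum_sub_distrib]
    field_simp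
    simp

theorem deviation_sub_deviation {N : ℕ} (x : Fin N → ℝ) (i j : Fin N) :
    deviation x i - deviation x j = x i - x j := by simp [deviation]

theorem deviation_add_smul {N : ℕ} (x d : Fin N → ℝ) (a : ℝ) (i : Fin N) :
    deviation (fun i => x i + a * d i) i = deviation x i + a * deviation d i := by
  simp only [deviation, Finset.sum_add_distrib, ← Finset.mul_sum]
  ring

theorem sum_deviation_sq_le {N : ℕ} (x : Fin N → ℝ) :
    ∑ i, deviation x i ^ 2 ≤ ∑ i, x i ^ 2 := by
  have h : ∑ i, x i ^ 2 = ∑ i, deviation x i ^ 2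
      + 2 * ((∑ j, x j) / N) * ∑ i, deviation x i + ∑ i : Fin N, ((∑ j, x j) / N) ^ 2 := by
    rw [Finset.mul_sum, ← Finset.sum_add_distrib, ← Finset.sum_add_distrib]
    exact Finset.sum_congr rfl fun i _ => by simp only [deviation]; ring
  rw [h, sum_deviation]
  have : 0 ≤ ∑ i : Fin N, ((∑ j, x j) / N) ^ 2 := Finset.sum_nonneg fun _ _ => sq_nonneg _
  linarith

/-- Deviations sum to zero, so in the linear term `deviation d` may be replaced by `d`; in the
quadratic term removing the average only decreases the norm. -/
theorem sum_deviation_add_smul_sq_le {N : ℕ} (x d : Fin N → ℝ) (a : ℝ) :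
    ∑ i, deviation (fun i => x i + a * d i) i ^ 2 ≤
      ∑ i, deviation x i ^ 2 + 2 * a * ∑ i, deviation x i * d i + a ^ 2 * ∑ i, d i ^ 2 := by
  have h1 : ∑ i, deviation (fun i => x i + a * d i) i ^ 2 = ∑ i, deviation x i ^ 2
      + 2 * a * ∑ i, deviation x i * d i + a ^ 2 * ∑ i, deviation d i ^ 2
      - 2 * a * ((∑ j, d j) / N) * ∑ i, deviation x i := by
    simp_rw [deviation_add_smul, Finset.mul_sum, ← Finset.sum_add_distrib,
      ← Finset.sum_sub_distrib]
    exact Finset.sum_congr rfl fun i _ => by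
      rw [show deviation d i = d i - (∑ j, d j) / N from rfl]; ring
  rw [h1, sum_deviation]
  have := mul_le_mul_of_nonneg_left (sum_deviation_sq_le d) (sq_nonneg a)
  linarith

/-- In a connected graph the values of a function at two vertices differ by at most the number
of vertices times the largest difference along an edge. -/
theorem abs_sub_le_of_connected {N : ℕ} {G : SimpleGraph (Fin N)} (hG : G.Connected)
    {x : Fin N → ℝ} {D : ℝ} (hx : ∀ i j, G.Adj i j → |x i - x j| ≤ D) (hD : 0 ≤ D)
    (i j : Fin N) : |x i - x j| ≤ N * D := by
  have walk : ∀ {i j : Fin N} (p : G.Walk i j), |x i - x j| ≤ p.length * D := by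
    intro i j p
    induction p with
    | nil => simp
    | @cons u v w h p ih =>
      have h1 := abs_sub_le (x u) (x v) (x w)
      have h2 := hx u v h
      rw [SimpleGraph.Walk.length_cons]
      push_cast
      linarith
  obtain ⟨p, hp⟩ := (hG.preconnected i j).exists_isPath
  refine (walk p).trans (mul_le_mul_of_nonneg_right ?_ hD)
  have := hp.length_lt
  rw [Fintype.card_fin] at this
  exact_mod_cast this.le

theorem abs_deviation_le {N : ℕ} {x : Fin N → ℝ} {D : ℝ} (hx : ∀ i j, |x i - x j| ≤ D)
    (i : Fin N) : |deviation x i| ≤ D := by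
  have hN : (0 : ℝ) < N := by exact_mod_cast (Nat.pos_of_ne_zero fun h => by subst h; exact i.elim0)
  have h1 : deviation x i = (∑ j, (x i - x j)) / N := by
    simp [deviation, Finset.sum_sub_distrib]
    field_simp
  rw [h1, abs_div, abs_of_pos hN, div_le_iff₀ hN]
  refine (Finset.abs_sum_le_sum_abs _ _).trans ?_
  refine (Finset.sum_le_card_nsmul _ _ D fun j _ => hx i j).trans ?_
  simp [mul_comm]

/-- A Poincaré inequality for weighted connected graphs. -/
theorem sum_deviation_sq_le_of_connected {N : ℕ} {G : SimpleGraph (Fin N)} (hG : G.Connected)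
    {w : Fin N → Fin N → ℝ} (hw : ∀ i j, 0 ≤ w i j) {a : ℝ} (ha : 0 < a)
    (hGw : ∀ i j, G.Adj i j → a ≤ w i j) (x : Fin N → ℝ) :
    a / N ^ 3 * ∑ i, deviation x i ^ 2 ≤ ∑ i, ∑ j, w i j * (x i - x j) ^ 2 := by
  set F := ∑ i, ∑ j, w i j * (x i - x j) ^ 2 with hF
  have hterm : ∀ i j, 0 ≤ w i j * (x i - x j) ^ 2 := fun i j => mul_nonneg (hw i j) (sq_nonneg _)
  have hF0 : 0 ≤ F := Finset.sum_nonneg fun i _ => Finset.sum_nonneg fun j _ => hterm i j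
  have hN : (0 : ℝ) < N := by
    obtain ⟨i⟩ := hG.nonempty
    exact_mod_cast (Nat.pos_of_ne_zero fun h => by subst h; exact i.elim0)
  have hedge : ∀ i j, G.Adj i j → |x i - x j| ≤ √(F / a) := by
    intro i j hij
    refine Real.abs_le_sqrt ?_
    rw [le_div_iff₀ ha]
    have h1 : w i j * (x i - x j) ^ 2 ≤ F :=
      (Finset.single_le_sum (f := fun j => w i j * (x i - x j) ^ 2) (fun j _ => hterm i j)
        (Finset.mem_univ j)).trans
      (Finset.single_le_sum (f := fun i => ∑ j, w i j * (x i - x j) ^ 2)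
        (fun i _ => Finset.sum_nonneg fun j _ => hterm i j) (Finset.mem_univ i))
    nlinarith [hGw i j hij, sq_nonneg (x i - x j)]
  -- A path has at most `N` edges, which gives `N ^ 2` after squaring; summing over the coordinates
  -- makes it the `N ^ 3` of the statement.
  have hdev : ∀ i, deviation x i ^ 2 ≤ N ^ 2 * (F / a) := by
    intro i
    have h1 := abs_deviation_le
      (abs_sub_le_of_connected hG hedge (Real.sqrt_nonneg _)) i
    have h2 := sq_le_sq' (by linarith [abs_nonneg (deviation x i)]) h1
    rwa [sq_abs, mul_pow, Real.sq_sqrt (by positivity)] at h2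
  have hsum := Finset.sum_le_card_nsmul Finset.univ _ _ fun i _ => hdev i
  rw [Finset.card_univ, Fintype.card_fin, nsmul_eq_mul] at hsum
  calc a / N ^ 3 * ∑ i, deviation x i ^ 2 ≤ a / N ^ 3 * (N * (N ^ 2 * (F / a))) := by gcongr
    _ = F := by field_simp

/-- Summation by parts: average the sum with its copy in which `i` and `j` are exchanged. -/
theorem sum_mul_sub_of_symm {N : ℕ} {w : Fin N → Fin N → ℝ} (hw : ∀ i j, w i j = w j i)
    (y x : Fin N → ℝ) :
    2 * ∑ i, ∑ j, w i j * (y i * (x j - x i))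
      = -∑ i, ∑ j, w i j * ((y i - y j) * (x i - x j)) := by
  have h : ∑ i, ∑ j, w i j * (y i * (x j - x i)) = ∑ i, ∑ j, w i j * (y j * (x i - x j)) := by
    rw [Finset.sum_comm]
    exact Finset.sum_congr rfl fun i _ => Finset.sum_congr rfl fun j _ => by rw [hw j i]
  rw [two_mul]
  nth_rw 2 [h]
  simp_rw [← Finset.sum_add_distrib, ← Finset.sum_neg_distrib]
  exact Finset.sum_congr rfl fun i _ => Finset.sum_congr rfl fun j _ => by ring

/-- The quadratic form of a weighted graph at `z` controls that at `x`, up to `‖z - x‖²`. -/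
theorem half_quadratic_form_le {N : ℕ} {w : Fin N → Fin N → ℝ} {A : ℝ}
    (hw : ∀ i j, 0 ≤ w i j) (hA : ∀ i j, w i j ≤ A) (x z : Fin N → ℝ) :
    (∑ i, ∑ j, w i j * (x i - x j) ^ 2) / 2 - 4 * N * A * ∑ i, (z i - x i) ^ 2
      ≤ ∑ i, ∑ j, w i j * (z i - z j) ^ 2 := by
  have h : 4 * N * A * ∑ i, (z i - x i) ^ 2
      = ∑ i, ∑ j, 2 * A * ((z i - x i) ^ 2 + (z j - x j) ^ 2) := by
    simp_rw [← Finset.mul_sum, Finset.sum_add_distrib]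
    simp [← Finset.mul_sum]
    ring
  rw [h, Finset.sum_div, ← Finset.sum_sub_distrib]
  refine Finset.sum_le_sum fun i _ => ?_
  rw [Finset.sum_div, ← Finset.sum_sub_distrib]
  refine Finset.sum_le_sum fun j _ => ?_
  have h1 : (x i - x j) ^ 2 / 2 - ((z i - x i) - (z j - x j)) ^ 2 ≤ (z i - z j) ^ 2 := by
    nlinarith [sq_nonneg ((x i - x j) + 2 * ((z i - x i) - (z j - x j)))]
  have h2 : ((z i - x i) - (z j - x j)) ^ 2 ≤ 2 * ((z i - x i) ^ 2 + (z j - x j) ^ 2) := by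
    nlinarith [sq_nonneg ((z i - x i) + (z j - x j))]
  have h3 := mul_le_mul_of_nonneg_left h1 (hw i j)
  have h4 := mul_le_mul_of_nonneg_left h2 (hw i j)
  have h5 : w i j * (2 * ((z i - x i) ^ 2 + (z j - x j) ^ 2))
      ≤ A * (2 * ((z i - x i) ^ 2 + (z j - x j) ^ 2)) :=
    mul_le_mul_of_nonneg_right (hA i j) (by positivity)
  nlinarith

/-- The squared negative part has derivative `-2 * max (-t) 0`, which is Lipschitz with constant 2;
this is the resulting quadratic upper bound, in the form needed for `integral_step_le`. -/
theorem max_neg_add_sq_le (t s : ℝ) :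
    max (-(t + s)) 0 ^ 2 ≤ max (-t) 0 ^ 2 - 2 * (max (-t) 0 * s) + s ^ 2 := by
  rcases max_cases (-(t + s)) 0 with ⟨h, h'⟩ | ⟨h, h'⟩ <;>
  rcases max_cases (-t) 0 with ⟨g, g'⟩ | ⟨g, g'⟩ <;> rw [h, g] <;> nlinarith [sq_nonneg (t + s)]

/-- The negative part is 1-Lipschitz, and `a ^ 2 ≤ 2 * b ^ 2 + 2 * (a - b) ^ 2`. It lets the state
be frozen at the start of a window. -/
theorem half_max_neg_sq_le (t s : ℝ) :
    max (-t) 0 ^ 2 / 2 - (s - t) ^ 2 ≤ max (-s) 0 ^ 2 := by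
  rcases max_cases (-s) 0 with ⟨h, h'⟩ | ⟨h, h'⟩ <;>
  rcases max_cases (-t) 0 with ⟨g, g'⟩ | ⟨g, g'⟩ <;> rw [h, g] <;>
    nlinarith [sq_nonneg (t - 2 * s), sq_nonneg (s - t)]

/-! ### Mean weights and the drift -/

namespace AirSystem

variable {N : ℕ} (S : AirSystem N)

/-- The weight that a link between `i` and `j` has whenever it is present. -/
noncomputable def linkWeight (i j : Fin N) : ℝ :=
  S.ρ * (S.p i * (1 - S.p j) + S.p j * (1 - S.p i)) * (S.Lam i j : ℝ)

theorem slot_pos (i j : Fin N) : 0 < S.p i * (1 - S.p j) + S.p j * (1 - S.p i) := by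
  obtain ⟨h1, h2⟩ := S.p_mem i
  obtain ⟨h3, h4⟩ := S.p_mem j
  have := mul_pos h1 (sub_pos.2 h4)
  have := mul_pos h3 (sub_pos.2 h2)
  linarith

theorem linkWeight_nonneg (i j : Fin N) : 0 ≤ S.linkWeight i j :=
  mul_nonneg (mul_nonneg S.ρ_pos.le (S.slot_pos i j).le) (S.Lam i j).2

theorem abar_nonneg (k : ℕ) (i j : Fin N) : 0 ≤ S.abar k i j := by
  unfold abar
  split_ifs
  exacts [S.linkWeight_nonneg i j, le_rfl]

theorem abar_symm (k : ℕ) (i j : Fin N) : S.abar k i j = S.abar k j i := by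
  unfold abar
  by_cases h : (S.graph k).Adj i j
  · rw [if_pos h, if_pos h.symm, S.Lam_symm i j, add_comm (S.p i * (1 - S.p j))]
  · rw [if_neg h, if_neg fun h' => h h'.symm]

theorem abar_of_not_adj {k : ℕ} {i j : Fin N} (h : ¬(S.graph k).Adj i j) : S.abar k i j = 0 :=
  if_neg h

theorem abar_of_adj {k : ℕ} {i j : Fin N} (h : (S.graph k).Adj i j) :
    S.abar k i j = S.linkWeight i j := if_pos h

theorem exists_abar_le : ∃ A, 0 ≤ A ∧ ∀ k i j, S.abar k i j ≤ A := by
  refine ⟨∑ i, ∑ j, S.linkWeight i j, Finset.sum_nonneg fun i _ => Finset.sum_nonneg fun j _ =>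
    S.linkWeight_nonneg i j, fun k i j => ?_⟩
  have h1 : S.abar k i j ≤ S.linkWeight i j := by
    by_cases h : (S.graph k).Adj i j
    · exact (S.abar_of_adj h).le
    · exact (S.abar_of_not_adj h).trans_le (S.linkWeight_nonneg i j)
  exact h1.trans <|
    (Finset.single_le_sum (f := fun j => S.linkWeight i j) (fun j _ => S.linkWeight_nonneg i j)
        (Finset.mem_univ j)).trans
      (Finset.single_le_sum (f := fun i => ∑ j, S.linkWeight i j)
        (fun i _ => Finset.sum_nonneg fun j _ => S.linkWeight_nonneg i j) (Finset.mem_univ i))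

/-- A link has the same weight whenever it is present and there are finitely many pairs, so the
bound is uniform in time. -/
theorem exists_le_abar : ∃ a, 0 < a ∧ ∀ k i j, (S.graph k).Adj i j → a ≤ S.abar k i j := by
  have h : ∀ᶠ a in 𝓝[>] (0 : ℝ), ∀ i j, 0 < S.linkWeight i j → a ≤ S.linkWeight i j := by
    refine eventually_all.2 fun i => eventually_all.2 fun j => ?_
    by_cases hij : 0 < S.linkWeight i j
    · filter_upwards [nhdsWithin_le_nhds (eventually_lt_nhds hij)] with a ha _ using ha.le
    · exact Eventually.of_forall fun a h => absurd h hij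
  obtain ⟨a, ha, ha0⟩ := (h.and self_mem_nhdsWithin).exists
  refine ⟨a, ha0, fun k i j hij => ?_⟩
  rw [S.abar_of_adj hij]
  exact ha i j (mul_pos (mul_pos S.ρ_pos (S.slot_pos i j)) (by exact_mod_cast S.Lam_pos k i j hij))

/-- The mean power, in units of `ρ`, with which the state `t` is sent. -/
noncomputable def power (t : ℝ) : ℝ := ‖S.root (S.ρ * t)‖ ^ 2 / S.ρ

theorem power_nonneg (t : ℝ) : 0 ≤ S.power t := div_nonneg (sq_nonneg _) S.ρ_pos.le

theorem power_of_nonneg {t : ℝ} (ht : 0 ≤ t) : S.power t = t := by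
  have h : 0 ≤ S.ρ * t := mul_nonneg S.ρ_pos.le ht
  have := S.ρ_pos.ne'
  rw [power, S.root_of_nonneg _ h, Complex.norm_real, Real.norm_eq_abs, sq_abs, Real.sq_sqrt h]
  field_simp

theorem power_le_abs (t : ℝ) : S.power t ≤ |t| := by
  rcases le_or_gt 0 t with ht | ht
  · rw [S.power_of_nonneg ht, abs_of_nonneg ht]
  · have := S.root_of_neg (S.ρ * t) (mul_neg_of_pos_of_neg S.ρ_pos ht)
    rw [power, div_le_iff₀ S.ρ_pos, mul_comm |t|]
    rwa [abs_mul, abs_of_pos S.ρ_pos] at this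

theorem norm_signal_sq (t : ℝ) : ‖S.signal t‖ ^ 2 = S.ρ * S.power t := by
  rw [signal, norm_mul, S.norm_u, mul_one, power]
  field_simp [S.ρ_pos.ne']

/-- Power is exact on nonnegative states and lies in `[0, |t|]` on negative ones. Hence the
departure of the drift from linearity is controlled by negative parts alone. -/
theorem abs_power_sub_le (t : ℝ) : |S.power t - t| ≤ 2 * max (-t) 0 := by
  rcases le_or_gt 0 t with ht | ht
  · rw [S.power_of_nonneg ht, sub_self, abs_zero]; positivity
  · have h1 := S.power_le_abs t
    have h2 := S.power_nonneg t
    rw [abs_of_neg ht] at h1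
    rw [max_eq_left (by linarith), abs_le]
    constructor <;> linarith

/-- The mean of the increment of the states at time `k`, per unit of step size. -/
noncomputable def drift (k : ℕ) (x : Fin N → ℝ) (i : Fin N) : ℝ :=
  ∑ j, S.abar k i j * (S.power (x j) - x i)

/-- Since `power` is at most the modulus, the sum is bounded by the Laplacian form of the vector of
moduli `|x i|`, which is nonpositive by summation by parts. -/
theorem sum_mul_drift_nonpos (k : ℕ) (x : Fin N → ℝ) : ∑ i, x i * S.drift k x i ≤ 0 := by
  have h1 : ∑ i, x i * S.drift k x i ≤ ∑ i, ∑ j, S.abar k i j * (|x i| * (|x j| - |x i|)) := by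
    refine Finset.sum_le_sum fun i _ => ?_
    rw [drift, Finset.mul_sum]
    refine Finset.sum_le_sum fun j _ => ?_
    have h2 : x i * S.power (x j) ≤ |x i| * |x j| :=
      mul_le_mul (le_abs_self _) (S.power_le_abs _) (S.power_nonneg _) (abs_nonneg _)
    have h3 := mul_le_mul_of_nonneg_left h2 (S.abar_nonneg k i j)
    have h4 := abs_mul_abs_self (x i)
    calc _ = S.abar k i j * (x i * S.power (x j)) - S.abar k i j * (x i * x i) := by ring
      _ ≤ S.abar k i j * (|x i| * |x j|) - S.abar k i j * (|x i| * |x i|) := by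
        rw [h4]; linarith
      _ = _ := by ring
  have h5 := sum_mul_sub_of_symm (S.abar_symm k) (fun i => |x i|) fun i => |x i|
  have h6 : 0 ≤ ∑ i, ∑ j, S.abar k i j * ((|x i| - |x j|) * (|x i| - |x j|)) :=
    Finset.sum_nonneg fun i _ => Finset.sum_nonneg fun j _ =>
      mul_nonneg (S.abar_nonneg k i j) (mul_self_nonneg _)
  linarith

/-- Neighbours contribute nonnegative power, which can only push a negative state upwards; dropping
it leaves the relaxation of the state itself, at the rate of its weighted degree. -/
theorem neg_max_neg_mul_drift_le (k : ℕ) (x : Fin N → ℝ) (i : Fin N) :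
    -(max (-x i) 0 * S.drift k x i) ≤ -((∑ j, S.abar k i j) * max (-x i) 0 ^ 2) := by
  rw [drift, neg_le_neg_iff, Finset.sum_mul, Finset.mul_sum]
  refine Finset.sum_le_sum fun j _ => ?_
  have h1 := mul_nonneg (mul_nonneg (S.abar_nonneg k i j) (le_max_right (-x i) 0))
    (S.power_nonneg (x j))
  have h2 : max (-x i) 0 ^ 2 = max (-x i) 0 * (-x i) := by
    rcases max_cases (-x i) 0 with ⟨h, h'⟩ | ⟨h, h'⟩ <;> rw [h] <;> ring
  rw [h2]
  linarith

/-- The linear part of the drift gives the quadratic form by summation by parts. The rest is bounded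
by deviations times negative parts and split by Young's inequality; `ε` stays free, to be chosen
depending on time. -/
theorem sum_deviation_mul_drift_le {A : ℝ} (hA : ∀ k i j, S.abar k i j ≤ A) (k : ℕ)
    (x : Fin N → ℝ) {ε : ℝ} (hε : 0 < ε) :
    2 * ∑ i, deviation x i * S.drift k x i ≤
      -(∑ i, ∑ j, S.abar k i j * (x i - x j) ^ 2)
      + 2 * A * N * (ε * ∑ i, deviation x i ^ 2 + (∑ i, max (-x i) 0 ^ 2) / ε) := by
  have h1 := sum_mul_sub_of_symm (S.abar_symm k) (deviation x) x
  simp_rw [deviation_sub_deviation, ← pow_two] at h1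
  have h2 : ∑ i, deviation x i * S.drift k x i
      = ∑ i, ∑ j, S.abar k i j * (deviation x i * (x j - x i))
        + ∑ i, ∑ j, S.abar k i j * (deviation x i * (S.power (x j) - x j)) := by
    simp_rw [← Finset.sum_add_distrib, drift, Finset.mul_sum]
    exact Finset.sum_congr rfl fun i _ => Finset.sum_congr rfl fun j _ => by ring
  have h3 : ∑ i, ∑ j, S.abar k i j * (deviation x i * (S.power (x j) - x j))
      ≤ ∑ i, ∑ j, A * (ε * deviation x i ^ 2 + max (-x j) 0 ^ 2 / ε) := by
    refine Finset.sum_le_sum fun i _ => Finset.sum_le_sum fun j _ => ?_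
    have h4 : deviation x i * (S.power (x j) - x j)
        ≤ ε * deviation x i ^ 2 + max (-x j) 0 ^ 2 / ε := by
      have h5 := S.abs_power_sub_le (x j)
      set m := max (-x j) 0
      set d := deviation x i
      have h6 : d * (S.power (x j) - x j) ≤ |d| * (2 * m) := by
        refine (le_abs_self _).trans ?_
        rw [abs_mul]
        gcongr
      have h7 : ε * d ^ 2 + m ^ 2 / ε - |d| * (2 * m) = (ε * |d| - m) ^ 2 / ε := by
        rw [← sq_abs d]; field_simp; ring
      have h8 : 0 ≤ (ε * |d| - m) ^ 2 / ε := by positivity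
      linarith
    have h9 : 0 ≤ ε * deviation x i ^ 2 + max (-x j) 0 ^ 2 / ε := by positivity
    exact (mul_le_mul_of_nonneg_left h4 (S.abar_nonneg k i j)).trans
      (mul_le_mul_of_nonneg_right (hA k i j) h9)
  have h10 : ∑ i : Fin N, ∑ j : Fin N, A * (ε * deviation x i ^ 2 + max (-x j) 0 ^ 2 / ε)
      = A * N * (ε * ∑ i, deviation x i ^ 2 + (∑ i, max (-x i) 0 ^ 2) / ε) := by
    simp_rw [← Finset.mul_sum, Finset.sum_add_distrib, ← Finset.sum_div]
    simp [← Finset.mul_sum]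
    ring
  rw [h10] at h3
  linarith

/-- The Poincaré inequality for the joint graph, with the weights summed over the window; `x` is the
same at all times of the window. -/
theorem window_deviation_le {a : ℝ} (ha : 0 < a)
    (hadj : ∀ k i j, (S.graph k).Adj i j → a ≤ S.abar k i j) {L k : ℕ}
    (hconn : (⨆ t ∈ Finset.range L, S.graph (k + t)).Connected) (x : Fin N → ℝ) :
    a / N ^ 3 * ∑ i, deviation x i ^ 2
      ≤ ∑ t ∈ Finset.range L, ∑ i, ∑ j, S.abar (k + t) i j * (x i - x j) ^ 2 := by
  have h := sum_deviation_sq_le_of_connected hconn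
    (w := fun i j => ∑ t ∈ Finset.range L, S.abar (k + t) i j)
    (fun i j => Finset.sum_nonneg fun t _ => S.abar_nonneg _ i j) ha ?_ x
  · refine h.trans_eq ?_
    simp_rw [Finset.sum_mul]
    rw [Finset.sum_comm]
    simp_rw [Finset.sum_comm (s := Finset.range L)]
    rw [Finset.sum_comm]
  · intro i j hij
    simp only [SimpleGraph.iSup_adj] at hij
    obtain ⟨t, ht, hij⟩ := hij
    exact (hadj _ i j hij).trans (Finset.single_le_sum (f := fun t => S.abar (k + t) i j)
      (fun t _ => S.abar_nonneg _ i j) ht)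

/-- With at least two agents, connectedness gives every agent a neighbour at some time of the
window. -/
theorem window_degree_ge (hN : 2 ≤ N) {a : ℝ}
    (hadj : ∀ k i j, (S.graph k).Adj i j → a ≤ S.abar k i j) {L k : ℕ}
    (hconn : (⨆ t ∈ Finset.range L, S.graph (k + t)).Connected) (i : Fin N) :
    a ≤ ∑ t ∈ Finset.range L, ∑ j, S.abar (k + t) i j := by
  have : Nontrivial (Fin N) := Fin.nontrivial_iff_two_le.2 hN
  obtain ⟨j, hij⟩ := hconn.preconnected.exists_adj_of_nontrivial i
  simp only [SimpleGraph.iSup_adj] at hij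
  obtain ⟨t, ht, hij⟩ := hij
  exact (hadj _ i j hij).trans <|
    (Finset.single_le_sum (f := fun j => S.abar (k + t) i j) (fun j _ => S.abar_nonneg _ i j)
      (Finset.mem_univ j)).trans
    (Finset.single_le_sum (f := fun t => ∑ j, S.abar (k + t) i j)
      (fun t _ => Finset.sum_nonneg fun j _ => S.abar_nonneg _ i j) ht)

end AirSystem

/-! ### Moments of the complex Gaussian law -/

section ComplexGaussian

variable (v : ℝ≥0)

instance isProbabilityMeasure_complexGaussian : IsProbabilityMeasure (complexGaussian v) :=
  Measure.isProbabilityMeasure_map (by fun_prop)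

theorem complexGaussian_map_re :
    (complexGaussian v).map Complex.re = gaussianReal 0 (v / 2) := by
  rw [complexGaussian, Measure.map_map (by fun_prop) (by fun_prop)]
  exact (Measure.map_fst_prod (μ := gaussianReal 0 (v / 2)) (ν := gaussianReal 0 (v / 2))).trans
    (by simp)

theorem complexGaussian_map_im :
    (complexGaussian v).map Complex.im = gaussianReal 0 (v / 2) := by
  rw [complexGaussian, Measure.map_map (by fun_prop) (by fun_prop)]
  exact (Measure.map_snd_prod (μ := gaussianReal 0 (v / 2)) (ν := gaussianReal 0 (v / 2))).trans
    (by simp)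

theorem memLp_id_complexGaussian (p : ℝ≥0∞) (hp : p ≠ ∞) :
    MemLp (fun z : ℂ => z) p (complexGaussian v) := by
  have hre : MemLp Complex.re p (complexGaussian v) := by
    have := memLp_id_gaussianReal' (μ := 0) (v := v / 2) p hp
    rw [← complexGaussian_map_re] at this
    exact this.comp_of_map (by fun_prop)
  have him : MemLp Complex.im p (complexGaussian v) := by
    have := memLp_id_gaussianReal' (μ := 0) (v := v / 2) p hp
    rw [← complexGaussian_map_im] at this
    exact this.comp_of_map (by fun_prop)
  exact memLp_re_im_iff.1 ⟨hre, him⟩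

theorem integral_sq_gaussianReal_zero (v : ℝ≥0) : ∫ x, x ^ 2 ∂(gaussianReal 0 v) = v := by
  rw [← variance_fun_id_gaussianReal (μ := 0) (v := v),
    variance_of_integral_eq_zero (by fun_prop) integral_id_gaussianReal]

theorem integral_id_complexGaussian : ∫ z, z ∂(complexGaussian v) = 0 := by
  have hint : Integrable (fun z : ℂ => z) (complexGaussian v) :=
    (memLp_id_complexGaussian v 1 (by simp)).integrable le_rfl
  apply Complex.ext
  · have h1 : ∫ z, z.re ∂(complexGaussian v) = 0 := by
      rw [← integral_id_gaussianReal (μ := 0) (v := v / 2), ← complexGaussian_map_re,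
        integral_map (by fun_prop) (by fun_prop)]
    exact (integral_re hint).symm.trans h1
  · have h1 : ∫ z, z.im ∂(complexGaussian v) = 0 := by
      rw [← integral_id_gaussianReal (μ := 0) (v := v / 2), ← complexGaussian_map_im,
        integral_map (by fun_prop) (by fun_prop)]
    exact (integral_im hint).symm.trans h1

theorem integral_norm_sq_complexGaussian : ∫ z, ‖z‖ ^ 2 ∂(complexGaussian v) = v := by
  have hL : MemLp (fun z : ℂ => z) 2 (complexGaussian v) :=
    memLp_id_complexGaussian v 2 (by simp)
  have h1 : ∫ z, z.re ^ 2 ∂(complexGaussian v) = (v / 2 : ℝ≥0) := by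
    rw [← integral_sq_gaussianReal_zero, ← complexGaussian_map_re,
      integral_map (by fun_prop) (by fun_prop)]
  have h2 : ∫ z, z.im ^ 2 ∂(complexGaussian v) = (v / 2 : ℝ≥0) := by
    rw [← integral_sq_gaussianReal_zero, ← complexGaussian_map_im,
      integral_map (by fun_prop) (by fun_prop)]
  have h3 : ∀ z : ℂ, ‖z‖ ^ 2 = z.re ^ 2 + z.im ^ 2 := fun z => by
    rw [← Complex.normSq_eq_norm_sq, Complex.normSq_apply]; ring
  have hre : Integrable (fun z : ℂ => z.re ^ 2) (complexGaussian v) := hL.re.integrable_sq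
  have him : Integrable (fun z : ℂ => z.im ^ 2) (complexGaussian v) := hL.im.integrable_sq
  simp_rw [h3]
  rw [integral_add hre him, h1, h2]
  push_cast
  ring

end ComplexGaussian

/-! ### Random inputs, the past, and independence -/

/-- The index set of all random inputs. -/
abbrev AirIndex (N : ℕ) : Type := (Fin N × ℕ) ⊕ ((Fin N × Fin N × ℕ) ⊕ (Fin N × ℕ))

/-- The time to which a random input belongs. -/
def AirIndex.time {N : ℕ} : AirIndex N → ℕ :=
  Sum.elim (fun q => q.2) (Sum.elim (fun q => q.2.2) fun q => q.2)

/-- The inputs before time `k`. -/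
def AirIndex.past {N : ℕ} (k : ℕ) : Set (AirIndex N) := {q | q.time < k}

namespace AirRandomness

variable {N : ℕ} {S : AirSystem N} {Ω : Type*} [mΩ : MeasurableSpace Ω] {μ : Measure Ω}
  (R : AirRandomness S μ)

/-- The family of all random inputs. -/
noncomputable def input : AirIndex N → Ω → ℂ :=
  Sum.elim (fun q : Fin N × ℕ => fun ω => ((R.γ q.1 q.2 ω : ℝ) : ℂ))
    (Sum.elim (fun q : Fin N × Fin N × ℕ => R.h q.1 q.2.1 q.2.2)
      (fun q : Fin N × ℕ => R.n q.1 q.2))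

/-- The information contained in the inputs with index in `T`. -/
noncomputable abbrev info (T : Set (AirIndex N)) : MeasurableSpace Ω :=
  ⨆ q ∈ T, MeasurableSpace.comap (R.input q) inferInstance

theorem measurable_input (q : AirIndex N) : Measurable (R.input q) := by
  rcases q with ⟨i, k⟩ | ⟨i, j, k⟩ | ⟨i, k⟩
  · exact Complex.measurable_ofReal.comp (R.γ_measurable i k)
  · exact R.h_measurable i j k
  · exact R.n_measurable i k

theorem info_le (T : Set (AirIndex N)) : R.info T ≤ mΩ :=
  iSup₂_le fun q _ => (R.measurable_input q).comap_le

theorem info_mono {T T' : Set (AirIndex N)} (h : T ⊆ T') : R.info T ≤ R.info T' :=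
  biSup_mono h

theorem measurable_input_info {T : Set (AirIndex N)} {q : AirIndex N} (hq : q ∈ T) :
    Measurable[R.info T] (R.input q) :=
  measurable_iff_comap_le.2 (le_iSup₂_of_le q hq le_rfl)

theorem measurable_γ_info {T : Set (AirIndex N)} {i : Fin N} {k : ℕ}
    (hq : Sum.inl (i, k) ∈ T) : Measurable[R.info T] (R.γ i k) :=
  Complex.measurable_re.comp (R.measurable_input_info hq)

theorem measurable_h_info {T : Set (AirIndex N)} {i j : Fin N} {k : ℕ}
    (hq : Sum.inr (Sum.inl (i, j, k)) ∈ T) : Measurable[R.info T] (R.h i j k) :=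
  R.measurable_input_info hq

theorem measurable_n_info {T : Set (AirIndex N)} {i : Fin N} {k : ℕ}
    (hq : Sum.inr (Sum.inr (i, k)) ∈ T) : Measurable[R.info T] (R.n i k) :=
  R.measurable_input_info hq

/-- Mutual independence makes the σ-algebras of disjoint sets of inputs independent. Every later
independence claim reduces to naming the inputs on which each side depends. -/
theorem indepFun_of_disjoint {β β' : Type*} [MeasurableSpace β] [MeasurableSpace β']
    {T T' : Set (AirIndex N)} (hT : Disjoint T T') {Y : Ω → β} {Z : Ω → β'}
    (hY : Measurable[R.info T] Y) (hZ : Measurable[R.info T'] Z) : IndepFun Y Z μ := by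
  rw [IndepFun_iff_Indep]
  have h := indep_iSup_of_disjoint (fun q => (R.measurable_input q).comap_le)
    ((iIndepFun_iff_iIndep _ _ _).1 R.indep) hT
  exact indep_of_indep_of_le_left (indep_of_indep_of_le_right h hZ.comap_le) hY.comap_le

theorem _root_.AirSystem.measurable_signal (S : AirSystem N) : Measurable S.signal :=
  (S.root_measurable.comp (measurable_const_mul S.ρ)).mul_const _

theorem _root_.AirSystem.measurable_power (S : AirSystem N) : Measurable S.power :=
  ((S.root_measurable.comp (measurable_const_mul S.ρ)).norm.pow_const 2).div_const _

/-- The part of the signal received by agent `i` that comes from the agents in `s`. -/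
noncomputable def partialReceived (k : ℕ) (i : Fin N) (s : Finset (Fin N)) (x : Fin N → ℝ)
    (ω : Ω) : ℂ :=
  (∑ j ∈ s, (R.Gam k i j ω : ℂ) * R.h i j k ω * S.signal (x j)) + R.n i k ω

theorem measurable_Gam_info {T : Set (AirIndex N)} {i j : Fin N} {k : ℕ}
    (hi : Sum.inl (i, k) ∈ T) (hj : Sum.inl (j, k) ∈ T) : Measurable[R.info T] (R.Gam k i j) :=
  ((R.measurable_γ_info hi).mul ((R.measurable_γ_info hj).const_sub 1)).add
    ((R.measurable_γ_info hj).mul ((R.measurable_γ_info hi).const_sub 1))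

theorem measurable_partialReceived_info {T : Set (AirIndex N)} {k : ℕ} {i : Fin N}
    {s : Finset (Fin N)} {X : Ω → Fin N → ℝ} (hX : ∀ j, Measurable[R.info T] fun ω => X ω j)
    (hγ : ∀ j, Sum.inl (j, k) ∈ T) (hh : ∀ j ∈ s, Sum.inr (Sum.inl (i, j, k)) ∈ T)
    (hn : Sum.inr (Sum.inr (i, k)) ∈ T) :
    Measurable[R.info T] fun ω => R.partialReceived k i s (X ω) ω := by
  refine Measurable.add (Finset.measurable_fun_sum s fun j hj => ?_) (R.measurable_n_info hn)
  exact ((Complex.measurable_ofReal.comp (R.measurable_Gam_info (hγ i) (hγ j))).mul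
    (R.measurable_h_info (hh j hj))).mul (S.measurable_signal.comp (hX j))

open Classical in
/-- The increment of the state of agent `i` per unit of step size. -/
noncomputable def drive (k : ℕ) (x : Fin N → ℝ) (i : Fin N) (ω : Ω) : ℝ :=
  if i ∈ S.failed k then 0
  else ‖R.received k x i ω‖ ^ 2 - (S.σ i : ℝ) ^ 2 - (∑ j, S.abar k i j) * x i

theorem state_succ (k : ℕ) (ω : Ω) (i : Fin N) :
    R.state (k + 1) ω i = R.state k ω i + S.α k * R.drive k (R.state k ω) i ω := by
  rw [state, drive]
  split_ifs <;> ring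

theorem measurable_drive_info {T : Set (AirIndex N)} {k : ℕ} {X : Ω → Fin N → ℝ}
    (hX : ∀ j, Measurable[R.info T] fun ω => X ω j) (hT : ∀ q : AirIndex N, q.time = k → q ∈ T)
    (i : Fin N) : Measurable[R.info T] fun ω => R.drive k (X ω) i ω := by
  unfold drive
  split_ifs
  · exact measurable_const
  · refine Measurable.sub (Measurable.sub (Measurable.pow_const (measurable_norm.comp ?_) 2)
      measurable_const) ((hX i).const_mul _)
    exact R.measurable_partialReceived_info hX (fun j => hT _ rfl) (fun j _ => hT _ rfl) (hT _ rfl)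

theorem measurable_state_info (k : ℕ) (i : Fin N) :
    Measurable[R.info (AirIndex.past k)] fun ω => R.state k ω i := by
  induction k generalizing i with
  | zero => exact measurable_const
  | succ k ih =>
    simp_rw [state_succ]
    have hX : ∀ j, Measurable[R.info (AirIndex.past (k + 1))] fun ω => R.state k ω j := fun j =>
      (ih j).mono (R.info_mono fun q hq => Nat.lt_succ_of_lt hq) le_rfl
    refine (hX i).add ((R.measurable_drive_info hX (fun q hq => ?_) i).const_mul _)
    exact Nat.lt_succ_of_le hq.le

theorem measurable_state (k : ℕ) (i : Fin N) : Measurable fun ω => R.state k ω i :=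
  (R.measurable_state_info k i).mono (R.info_le _) le_rfl

theorem measurable_drive (k : ℕ) (i : Fin N) :
    Measurable fun ω => R.drive k (R.state k ω) i ω :=
  (R.measurable_drive_info (T := Set.univ)
    (fun j => (R.measurable_state_info k j).mono (R.info_mono (Set.subset_univ _)) le_rfl)
    (fun _ _ => Set.mem_univ _) i).mono (R.info_le _) le_rfl

/-! ### Moments of the inputs of one time step -/

theorem integral_γ (i : Fin N) (k : ℕ) : ∫ ω, R.γ i k ω ∂μ = S.p i := by
  have h : R.γ i k = Set.indicator {ω | R.γ i k ω = 1} fun _ => (1 : ℝ) := by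
    ext ω
    rcases R.γ_values i k ω with h | h <;> simp [h]
  have hm : MeasurableSet {ω | R.γ i k ω = 1} :=
    R.γ_measurable i k (measurableSet_singleton 1)
  rw [h, integral_indicator_const _ hm, measureReal_def, R.γ_law,
    ENNReal.toReal_ofReal (S.p_mem i).1.le, smul_eq_mul, mul_one]

theorem integrable_γ [IsProbabilityMeasure μ] (i : Fin N) (k : ℕ) : Integrable (R.γ i k) μ :=
  Integrable.of_bound (R.γ_measurable i k).aestronglyMeasurable 1
    (Eventually.of_forall fun ω => by rcases R.γ_values i k ω with h | h <;> simp [h])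

theorem Gam_sq (k : ℕ) (i j : Fin N) (ω : Ω) : R.Gam k i j ω ^ 2 = R.Gam k i j ω := by
  unfold Gam
  rcases R.γ_values i k ω with h | h <;> rcases R.γ_values j k ω with h' | h' <;> simp [h, h']

theorem abs_Gam_le (k : ℕ) (i j : Fin N) (ω : Ω) : |R.Gam k i j ω| ≤ 1 := by
  unfold Gam
  rcases R.γ_values i k ω with h | h <;> rcases R.γ_values j k ω with h' | h' <;> simp [h, h']

theorem integral_Gam [IsProbabilityMeasure μ] (k : ℕ) {i j : Fin N} (hij : i ≠ j) :
    ∫ ω, R.Gam k i j ω ∂μ = S.p i * (1 - S.p j) + S.p j * (1 - S.p i) := by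
  have hind : IndepFun (R.γ i k) (R.γ j k) μ :=
    R.indepFun_of_disjoint (T := {Sum.inl (i, k)}) (T' := {Sum.inl (j, k)})
      (by simpa using hij) (R.measurable_γ_info rfl) (R.measurable_γ_info rfl)
  have h1 := hind.integral_fun_mul_eq_mul_integral
    (R.γ_measurable i k).aestronglyMeasurable (R.γ_measurable j k).aestronglyMeasurable
  have h2 : Integrable (fun ω => R.γ i k ω * R.γ j k ω) μ :=
    hind.integrable_mul (R.integrable_γ i k) (R.integrable_γ j k)
  have h3 : ∀ ω, R.Gam k i j ω = R.γ i k ω + R.γ j k ω - 2 * (R.γ i k ω * R.γ j k ω) :=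
    fun ω => by rw [Gam]; ring
  have h4 : Integrable (fun ω => R.γ i k ω + R.γ j k ω) μ :=
    (R.integrable_γ i k).add (R.integrable_γ j k)
  simp_rw [h3]
  rw [integral_sub h4 (h2.const_mul 2),
    integral_add (R.integrable_γ i k) (R.integrable_γ j k), integral_const_mul, h1,
    R.integral_γ, R.integral_γ]
  ring

theorem memLp_h (i j : Fin N) (k : ℕ) : MemLp (R.h i j k) 4 μ := by
  have := memLp_id_complexGaussian (S.Lam i j) 4 (by simp)
  rw [← R.h_law i j k] at this
  exact this.comp_of_map (R.h_measurable i j k).aemeasurable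

theorem memLp_n (i : Fin N) (k : ℕ) : MemLp (R.n i k) 4 μ := by
  have := memLp_id_complexGaussian (S.σ i ^ 2) 4 (by simp)
  rw [← R.n_law i k] at this
  exact this.comp_of_map (R.n_measurable i k).aemeasurable

theorem integral_h (i j : Fin N) (k : ℕ) : ∫ ω, R.h i j k ω ∂μ = 0 := by
  rw [← integral_id_complexGaussian (S.Lam i j), ← R.h_law i j k,
    integral_map (R.h_measurable i j k).aemeasurable (by fun_prop)]

theorem integral_norm_h_sq (i j : Fin N) (k : ℕ) :
    ∫ ω, ‖R.h i j k ω‖ ^ 2 ∂μ = S.Lam i j := by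
  rw [← integral_norm_sq_complexGaussian (S.Lam i j), ← R.h_law i j k,
    integral_map (R.h_measurable i j k).aemeasurable (by fun_prop)]

theorem integral_norm_n_sq (i : Fin N) (k : ℕ) :
    ∫ ω, ‖R.n i k ω‖ ^ 2 ∂μ = (S.σ i : ℝ) ^ 2 := by
  rw [← NNReal.coe_pow, ← integral_norm_sq_complexGaussian (S.σ i ^ 2), ← R.n_law i k,
    integral_map (R.n_measurable i k).aemeasurable (by fun_prop)]

/-- The total fourth power of the fading and noise at time `k`. -/
noncomputable def magnitude (k : ℕ) (ω : Ω) : ℝ :=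
  ∑ i, ∑ j, ‖R.h i j k ω‖ ^ 4 + ∑ i, ‖R.n i k ω‖ ^ 4

theorem magnitude_nonneg (k : ℕ) (ω : Ω) : 0 ≤ R.magnitude k ω := by
  unfold magnitude; positivity

theorem norm_h_pow_le (k : ℕ) (i : Fin N) (ω : Ω) :
    ∑ j, ‖R.h i j k ω‖ ^ 4 + ‖R.n i k ω‖ ^ 4 ≤ R.magnitude k ω :=
  add_le_add
    (Finset.single_le_sum (f := fun i => ∑ j, ‖R.h i j k ω‖ ^ 4) (fun i _ => by positivity)
      (Finset.mem_univ i))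
    (Finset.single_le_sum (f := fun i => ‖R.n i k ω‖ ^ 4) (fun i _ => by positivity)
      (Finset.mem_univ i))

theorem integrable_magnitude (k : ℕ) : Integrable (R.magnitude k) μ := by
  refine (integrable_finsetSum _ fun i _ => integrable_finsetSum _ fun j _ => ?_).add
    (integrable_finsetSum _ fun i _ => ?_)
  · exact (R.memLp_h i j k).integrable_norm_pow (p := 4) (by simp)
  · exact (R.memLp_n i k).integrable_norm_pow (p := 4) (by simp)

theorem exists_integral_magnitude_eq : ∃ m, 0 ≤ m ∧ ∀ k, ∫ ω, R.magnitude k ω ∂μ = m := by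
  have h : ∀ k, ∫ ω, R.magnitude k ω ∂μ
      = ∑ i, ∑ j, ∫ z, ‖z‖ ^ 4 ∂(complexGaussian (S.Lam i j))
        + ∑ i, ∫ z, ‖z‖ ^ 4 ∂(complexGaussian (S.σ i ^ 2)) := by
    intro k
    have hh : ∀ i j, Integrable (fun ω => ‖R.h i j k ω‖ ^ 4) μ := fun i j =>
      (R.memLp_h i j k).integrable_norm_pow (p := 4) (by simp)
    have hn : ∀ i, Integrable (fun ω => ‖R.n i k ω‖ ^ 4) μ := fun i =>
      (R.memLp_n i k).integrable_norm_pow (p := 4) (by simp)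
    unfold magnitude
    rw [integral_add (integrable_finsetSum _ fun i _ => integrable_finsetSum _ fun j _ => hh i j)
      (integrable_finsetSum _ fun i _ => hn i),
      integral_finsetSum _ fun i _ => integrable_finsetSum _ fun j _ => hh i j,
      integral_finsetSum _ fun i _ => hn i]
    congr 1
    · refine Finset.sum_congr rfl fun i _ => ?_
      rw [integral_finsetSum _ fun j _ => hh i j]
      refine Finset.sum_congr rfl fun j _ => ?_
      rw [← R.h_law i j k, integral_map (R.h_measurable i j k).aemeasurable (by fun_prop)]
    · refine Finset.sum_congr rfl fun i _ => ?_
      rw [← R.n_law i k, integral_map (R.n_measurable i k).aemeasurable (by fun_prop)]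
  exact ⟨_, (integral_nonneg (R.magnitude_nonneg 0)).trans_eq (h 0), h⟩

theorem measurable_magnitude_info (k : ℕ) :
    Measurable[R.info {q | q.time = k}] (R.magnitude k) := by
  have hh : ∀ i j, Measurable[R.info {q | q.time = k}] fun ω => ‖R.h i j k ω‖ ^ 4 := fun i j =>
    have h : Measurable[R.info {q | q.time = k}] (R.h i j k) :=
      R.measurable_h_info (Set.mem_ofPred.2 rfl)
    (measurable_norm.comp h).pow_const 4
  have hn : ∀ i, Measurable[R.info {q | q.time = k}] fun ω => ‖R.n i k ω‖ ^ 4 := fun i =>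
    have h : Measurable[R.info {q | q.time = k}] (R.n i k) :=
      R.measurable_n_info (Set.mem_ofPred.2 rfl)
    (measurable_norm.comp h).pow_const 4
  exact Measurable.add (Finset.measurable_fun_sum _ fun i _ => Finset.measurable_fun_sum _ fun j _ =>
    hh i j) (Finset.measurable_fun_sum _ fun i _ => hn i)

end AirRandomness

/-! ### Second moments of states and increments -/

namespace AirRandomness

variable {N : ℕ} {S : AirSystem N} {Ω : Type*} [mΩ : MeasurableSpace Ω] {μ : Measure Ω}
  (R : AirRandomness S μ)

/-- The signal is a square root of the state, so its fourth power grows only quadratically in the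
state. The bound is a product of present inputs and past state, whose mean factors by independence.
-/
theorem norm_partialReceived_pow_le (k : ℕ) (i : Fin N) (s : Finset (Fin N)) (x : Fin N → ℝ)
    (ω : Ω) : ‖R.partialReceived k i s x ω‖ ^ 4
      ≤ 8 * (N ^ 3 * S.ρ ^ 2 + 1) * (R.magnitude k ω * (1 + ∑ j, x j ^ 2)) := by
  set b : Fin N → ℝ := fun j => ‖R.h i j k ω‖ * ‖S.signal (x j)‖ with hb
  have hb0 : ∀ j, 0 ≤ b j := fun j => by positivity
  have h1 : ‖R.partialReceived k i s x ω‖ ≤ ∑ j, b j + ‖R.n i k ω‖ := by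
    refine (norm_add_le _ _).trans (add_le_add_left ((norm_sum_le _ _).trans ?_) _)
    refine (Finset.sum_le_sum (g := b) fun j _ => ?_).trans
      (Finset.sum_le_sum_of_subset_of_nonneg (Finset.subset_univ s) fun j _ _ => hb0 j)
    rw [norm_mul, norm_mul, Complex.norm_real, Real.norm_eq_abs, mul_assoc]
    exact mul_le_of_le_one_left (hb0 j) (R.abs_Gam_le k i j ω)
  have hx : ∀ j, x j ^ 2 ≤ ∑ j, x j ^ 2 := fun j =>
    Finset.single_le_sum (f := fun j => x j ^ 2) (fun j _ => sq_nonneg _) (Finset.mem_univ j)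
  have h2 : ∀ j, b j ^ 4 ≤ S.ρ ^ 2 * (‖R.h i j k ω‖ ^ 4 * ∑ j, x j ^ 2) := by
    intro j
    have h3 : b j ^ 4 = S.ρ ^ 2 * (‖R.h i j k ω‖ ^ 4 * S.power (x j) ^ 2) := by
      calc b j ^ 4 = ‖R.h i j k ω‖ ^ 4 * (‖S.signal (x j)‖ ^ 2) ^ 2 := by rw [hb]; ring
        _ = _ := by rw [S.norm_signal_sq]; ring
    rw [h3]
    have h4 : S.power (x j) ^ 2 ≤ x j ^ 2 := by
      rw [← sq_abs (x j)]
      exact pow_le_pow_left₀ (S.power_nonneg _) (S.power_le_abs _) 2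
    have := h4.trans (hx j)
    gcongr
  have hcard : (∑ j, b j) ^ 4 ≤ N ^ 3 * ∑ j, b j ^ 4 := by
    simpa using pow_sum_le_card_mul_sum_pow (s := Finset.univ) (fun j _ => hb0 j) 3
  have h5 : ∑ j, b j ^ 4 ≤ S.ρ ^ 2 * ((∑ j, ‖R.h i j k ω‖ ^ 4) * ∑ j, x j ^ 2) := by
    rw [Finset.sum_mul, Finset.mul_sum]
    exact Finset.sum_le_sum fun j _ => h2 j
  have hmag := R.norm_h_pow_le k i ω
  have hh0 : 0 ≤ ∑ j, ‖R.h i j k ω‖ ^ 4 := by positivity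
  have hn0 : 0 ≤ ‖R.n i k ω‖ ^ 4 := by positivity
  have hx0 : 0 ≤ ∑ j, x j ^ 2 := by positivity
  set m := R.magnitude k ω
  have hm0 : 0 ≤ m := R.magnitude_nonneg k ω
  calc ‖R.partialReceived k i s x ω‖ ^ 4 ≤ (∑ j, b j + ‖R.n i k ω‖) ^ 4 := by gcongr
    _ ≤ 2 ^ (4 - 1) * ((∑ j, b j) ^ 4 + ‖R.n i k ω‖ ^ 4) :=
      add_pow_le (Finset.sum_nonneg fun j _ => hb0 j) (norm_nonneg _) 4
    _ ≤ 8 * (N ^ 3 * (S.ρ ^ 2 * (m * (1 + ∑ j, x j ^ 2))) + m * (1 + ∑ j, x j ^ 2)) := by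
      norm_num only
      have h6 : (∑ j, ‖R.h i j k ω‖ ^ 4) * ∑ j, x j ^ 2 ≤ m * (1 + ∑ j, x j ^ 2) := by
        apply mul_le_mul <;> linarith
      have h7 : ‖R.n i k ω‖ ^ 4 ≤ m * (1 + ∑ j, x j ^ 2) := by nlinarith
      have h8 : (N : ℝ) ^ 3 * ∑ j, b j ^ 4
          ≤ N ^ 3 * (S.ρ ^ 2 * (m * (1 + ∑ j, x j ^ 2))) :=
        mul_le_mul_of_nonneg_left (h5.trans (mul_le_mul_of_nonneg_left h6 (sq_nonneg _)))
          (by positivity)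
      linarith
    _ = _ := by ring

theorem exists_drive_sq_le : ∃ C, 0 ≤ C ∧ ∀ k i x ω, R.drive k x i ω ^ 2
    ≤ C * ((1 + R.magnitude k ω) * (1 + ∑ j, x j ^ 2)) := by
  obtain ⟨A, hA0, hA⟩ := S.exists_abar_le
  set B : ℝ := ∑ i, (S.σ i : ℝ) ^ 4 with hB
  have hB0 : 0 ≤ B := Finset.sum_nonneg fun i _ => by positivity
  set D : ℝ := 8 * (N ^ 3 * S.ρ ^ 2 + 1) with hD
  have hD0 : 0 ≤ D := by positivity
  refine ⟨3 * (D + B + (N * A) ^ 2), by positivity, fun k i x ω => ?_⟩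
  have hm0 := R.magnitude_nonneg k ω
  have hx0 : 0 ≤ ∑ j, x j ^ 2 := by positivity
  set m := R.magnitude k ω
  set X := ∑ j, x j ^ 2
  unfold drive
  split_ifs
  · rw [zero_pow two_ne_zero]; positivity
  · have h1 : ‖R.received k x i ω‖ ^ 4 ≤ D * (m * (1 + X)) :=
      R.norm_partialReceived_pow_le k i _ x ω
    have h2 : (S.σ i : ℝ) ^ 4 ≤ B :=
      Finset.single_le_sum (f := fun i => (S.σ i : ℝ) ^ 4) (fun i _ => by positivity)
        (Finset.mem_univ i)
    have h3 : x i ^ 2 ≤ X :=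
      Finset.single_le_sum (f := fun j => x j ^ 2) (fun j _ => sq_nonneg _) (Finset.mem_univ i)
    have h4 : ∑ j, S.abar k i j ≤ N * A := by
      simpa using Finset.sum_le_card_nsmul Finset.univ _ A fun j _ => hA k i j
    have h5 : (∑ j, S.abar k i j) ^ 2 ≤ (N * A) ^ 2 :=
      pow_le_pow_left₀ (Finset.sum_nonneg fun j _ => S.abar_nonneg k i j) h4 2
    set r := ‖R.received k x i ω‖
    set d := ∑ j, S.abar k i j
    have h6 : (r ^ 2 - (S.σ i : ℝ) ^ 2 - d * x i) ^ 2
        ≤ 3 * (r ^ 4 + (S.σ i : ℝ) ^ 4 + d ^ 2 * x i ^ 2) := by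
      nlinarith [sq_nonneg (r ^ 2 + (S.σ i : ℝ) ^ 2), sq_nonneg (r ^ 2 + d * x i),
        sq_nonneg ((S.σ i : ℝ) ^ 2 - d * x i)]
    have h7 : d ^ 2 * x i ^ 2 ≤ (N * A) ^ 2 * X :=
      mul_le_mul h5 h3 (sq_nonneg _) (by positivity)
    have h8 : D * (m * (1 + X)) ≤ D * ((1 + m) * (1 + X)) := by gcongr; linarith
    have h9 : B ≤ B * ((1 + m) * (1 + X)) := le_mul_of_one_le_right hB0 (by nlinarith)
    have h10 : (N * A) ^ 2 * X ≤ (N * A) ^ 2 * ((1 + m) * (1 + X)) := by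
      gcongr; nlinarith
    linarith

theorem partialReceived_insert (k : ℕ) (i : Fin N) {s : Finset (Fin N)} {j : Fin N} (hj : j ∉ s)
    (x : Fin N → ℝ) (ω : Ω) : R.partialReceived k i (insert j s) x ω
      = (R.Gam k i j ω : ℂ) * R.h i j k ω * S.signal (x j) + R.partialReceived k i s x ω := by
  simp only [partialReceived, Finset.sum_insert hj, add_assoc]

theorem indepFun_magnitude_state (k : ℕ) {Y : Ω → ℝ}
    (hY : Measurable[R.info (AirIndex.past k)] Y) : IndepFun (R.magnitude k) Y μ := by
  refine R.indepFun_of_disjoint (Set.disjoint_left.2 fun q hq hq' => ?_)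
    (R.measurable_magnitude_info k) hY
  exact absurd hq (Nat.ne_of_lt hq')

theorem measurable_one_add_sum_sq (k : ℕ) :
    Measurable[R.info (AirIndex.past k)] fun ω => 1 + ∑ j, R.state k ω j ^ 2 :=
  (Finset.measurable_fun_sum _ fun j _ => (R.measurable_state_info k j).pow_const 2).const_add 1

theorem integrable_sum_sq {k : ℕ} (hX : ∀ j, MemLp (fun ω => R.state k ω j) 2 μ) :
    Integrable (fun ω => ∑ j, R.state k ω j ^ 2) μ :=
  integrable_finsetSum _ fun j _ => (hX j).integrable_sq

variable [IsProbabilityMeasure μ]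

theorem integrable_magnitude_mul {k : ℕ} (hX : ∀ j, MemLp (fun ω => R.state k ω j) 2 μ) :
    Integrable (fun ω => R.magnitude k ω * (1 + ∑ j, R.state k ω j ^ 2)) μ :=
  (R.indepFun_magnitude_state k (R.measurable_one_add_sum_sq k)).integrable_mul
    (R.integrable_magnitude k) ((integrable_const 1).add (R.integrable_sum_sq hX))

theorem integrable_one_add_magnitude_mul {k : ℕ}
    (hX : ∀ j, MemLp (fun ω => R.state k ω j) 2 μ) :
    Integrable (fun ω => (1 + R.magnitude k ω) * (1 + ∑ j, R.state k ω j ^ 2)) μ := by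
  simp_rw [add_mul (1 : ℝ), one_mul]
  exact ((integrable_const 1).add (R.integrable_sum_sq hX)).add (R.integrable_magnitude_mul hX)

theorem memLp_drive {k : ℕ} (hX : ∀ j, MemLp (fun ω => R.state k ω j) 2 μ) (i : Fin N) :
    MemLp (fun ω => R.drive k (R.state k ω) i ω) 2 μ := by
  obtain ⟨C, -, hC⟩ := R.exists_drive_sq_le
  have hm := (R.measurable_drive k i)
  refine (memLp_two_iff_integrable_sq hm.aestronglyMeasurable).2 ?_
  refine ((R.integrable_one_add_magnitude_mul hX).const_mul C).mono'
    (hm.pow_const 2).aestronglyMeasurable (Eventually.of_forall fun ω => ?_)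
  rw [Real.norm_eq_abs, abs_of_nonneg (sq_nonneg _)]
  exact hC k i _ ω

/-- The induction closes at exponent 2 because the square of `drive` has quadratic growth in the
state, with an integrable coefficient independent of it. -/
theorem memLp_state (k : ℕ) (i : Fin N) : MemLp (fun ω => R.state k ω i) 2 μ := by
  induction k generalizing i with
  | zero => exact memLp_const (S.x₀ i)
  | succ k ih =>
    simp_rw [state_succ]
    exact (ih i).add ((R.memLp_drive ih i).const_mul _)

theorem exists_integral_drive_sq_le : ∃ C, 0 ≤ C ∧ ∀ k i,
    ∫ ω, R.drive k (R.state k ω) i ω ^ 2 ∂μ ≤ C * (1 + ∫ ω, ∑ j, R.state k ω j ^ 2 ∂μ) := by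
  obtain ⟨C, hC0, hC⟩ := R.exists_drive_sq_le
  obtain ⟨m, hm0, hm⟩ := R.exists_integral_magnitude_eq
  refine ⟨C * (1 + m), by positivity, fun k i => ?_⟩
  have hX := R.memLp_state k
  have hint : Integrable (fun ω => 1 + ∑ j, R.state k ω j ^ 2) μ :=
    (integrable_const 1).add (R.integrable_sum_sq hX)
  refine (integral_mono (R.memLp_drive hX i).integrable_sq
    ((R.integrable_one_add_magnitude_mul hX).const_mul C) fun ω => hC k i _ ω).trans_eq ?_
  have h1 := (R.indepFun_magnitude_state k
    (R.measurable_one_add_sum_sq k)).integral_fun_mul_eq_mul_integral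
    (R.integrable_magnitude k).aestronglyMeasurable hint.aestronglyMeasurable
  have h2 : ∫ ω, (1 + ∑ j, R.state k ω j ^ 2) ∂μ = 1 + ∫ ω, ∑ j, R.state k ω j ^ 2 ∂μ := by
    rw [integral_add (integrable_const 1) (R.integrable_sum_sq hX)]
    simp
  simp_rw [add_mul (1 : ℝ), one_mul]
  rw [integral_const_mul, integral_add hint (R.integrable_magnitude_mul hX), h1, h2, hm]
  ring

theorem memLp_norm_partialReceived_sq (k : ℕ) (i : Fin N) (s : Finset (Fin N)) :
    MemLp (fun ω => ‖R.partialReceived k i s (R.state k ω) ω‖ ^ 2) 2 μ := by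
  have hm : Measurable fun ω => R.partialReceived k i s (R.state k ω) ω :=
    (R.measurable_partialReceived_info (T := Set.univ)
      (fun j => (R.measurable_state_info k j).mono (R.info_mono (Set.subset_univ _)) le_rfl)
      (fun j => Set.mem_univ _) (fun j _ => Set.mem_univ _) (Set.mem_univ _)).mono (R.info_le _) le_rfl
  refine (memLp_two_iff_integrable_sq (hm.norm.pow_const 2).aestronglyMeasurable).2 ?_
  refine ((R.integrable_magnitude_mul (R.memLp_state k)).const_mul
    (8 * (N ^ 3 * S.ρ ^ 2 + 1))).mono' ((hm.norm.pow_const 2).pow_const 2).aestronglyMeasurable (Eventually.of_forall fun ω => ?_)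
  rw [Real.norm_eq_abs, abs_of_nonneg (sq_nonneg _), ← pow_mul]
  exact R.norm_partialReceived_pow_le k i s _ ω

theorem memLp_power (k : ℕ) (j : Fin N) : MemLp (fun ω => S.power (R.state k ω j)) 2 μ :=
  (R.memLp_state k j).of_le (S.measurable_power.comp (R.measurable_state k j)).aestronglyMeasurable
    (Eventually.of_forall fun ω => by
      rw [Real.norm_eq_abs, abs_of_nonneg (S.power_nonneg _)]
      exact S.power_le_abs _)

/-! ### The conditional mean of the increments -/

/-- The fading of a single link has mean zero and is independent of everything else, so the
cross terms vanish in the mean. -/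
theorem integral_mul_norm_partialReceived_insert_sq {k : ℕ} {Y : Ω → ℝ}
    (hY : Measurable[R.info (AirIndex.past k)] Y) (hY2 : MemLp Y 2 μ) {i : Fin N}
    {s : Finset (Fin N)} {j : Fin N} (hj : j ∉ s) (hij : i ≠ j) :
    ∫ ω, Y ω * ‖R.partialReceived k i (insert j s) (R.state k ω) ω‖ ^ 2 ∂μ
      = S.linkWeight i j * ∫ ω, Y ω * S.power (R.state k ω j) ∂μ
        + ∫ ω, Y ω * ‖R.partialReceived k i s (R.state k ω) ω‖ ^ 2 ∂μ := by
  -- The inputs are split into this one fading variable and all others; `T` does not involve it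
  -- because `j ∉ s`.
  set H : AirIndex N := Sum.inr (Sum.inl (i, j, k)) with hH
  have hpast : AirIndex.past k ⊆ ({H}ᶜ : Set (AirIndex N)) := fun q hq hqH => by
    rw [Set.mem_singleton_iff.1 hqH] at hq
    exact lt_irrefl k hq
  have hγ : ∀ l, (Sum.inl (l, k) : AirIndex N) ∈ ({H}ᶜ : Set (AirIndex N)) := fun l => by
    simp [hH]
  have hXo : ∀ l, Measurable[R.info {H}ᶜ] fun ω => R.state k ω l := fun l =>
    (R.measurable_state_info k l).mono (R.info_mono hpast) le_rfl
  have hYo : Measurable[R.info {H}ᶜ] Y := hY.mono (R.info_mono hpast) le_rfl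
  have hTo : Measurable[R.info {H}ᶜ] fun ω => R.partialReceived k i s (R.state k ω) ω := by
    refine R.measurable_partialReceived_info hXo hγ (fun l hl => ?_) (by simp [hH])
    simp only [hH, Set.mem_compl_iff, Set.mem_singleton_iff, Sum.inr.injEq, Sum.inl.injEq,
      Prod.mk.injEq, true_and, and_true]
    rintro rfl
    exact hj hl
  have hGo : Measurable[R.info {H}ᶜ] (R.Gam k i j) := R.measurable_Gam_info (hγ i) (hγ j)
  have hho : Measurable[R.info {H}] (R.h i j k) := R.measurable_h_info rfl
  set T : Ω → ℂ := fun ω => R.partialReceived k i s (R.state k ω) ω with hT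
  set T' : Ω → ℂ := fun ω => R.partialReceived k i (insert j s) (R.state k ω) ω with hT'
  set a : Ω → ℂ := fun ω => (R.Gam k i j ω : ℂ) * R.h i j k ω * S.signal (R.state k ω j) with ha
  have hT'eq : ∀ ω, T' ω = a ω + T ω := fun ω => R.partialReceived_insert k i hj _ ω
  set Z : Ω → ℂ := fun ω => (Y ω : ℂ) * (R.Gam k i j ω : ℂ) * S.signal (R.state k ω j)
    * (starRingEnd ℂ) (T ω) with hZ
  have hZo : Measurable[R.info {H}ᶜ] Z :=
    (((Complex.measurable_ofReal.comp hYo).mul (Complex.measurable_ofReal.comp hGo)).mul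
      (S.measurable_signal.comp (hXo j))).mul (Complex.continuous_conj.measurable.comp hTo)
  have hhm : Measurable (R.h i j k) := R.h_measurable i j k
  have hZm : Measurable Z := hZo.mono (R.info_le _) le_rfl
  have hYm : Measurable Y := hYo.mono (R.info_le _) le_rfl
  have hTm : Measurable T := hTo.mono (R.info_le _) le_rfl
  have hGm : Measurable (R.Gam k i j) := hGo.mono (R.info_le _) le_rfl
  have ham : Measurable a := ((Complex.measurable_ofReal.comp hGm).mul hhm).mul
    (S.measurable_signal.comp (R.measurable_state k j))
  have hdisj : Disjoint ({H} : Set (AirIndex N)) {H}ᶜ := disjoint_compl_right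
  have hiT : Integrable (fun ω => Y ω * ‖T ω‖ ^ 2) μ :=
    hY2.integrable_mul (R.memLp_norm_partialReceived_sq k i s)
  have hiT' : Integrable (fun ω => Y ω * ‖T' ω‖ ^ 2) μ :=
    hY2.integrable_mul (R.memLp_norm_partialReceived_sq k i (insert j s))
  -- The new term is the difference of two received signals whose squared norms are already known to
  -- be square-integrable.
  have hia : Integrable (fun ω => Y ω * ‖a ω‖ ^ 2) μ := by
    refine ((hiT.norm.const_mul 2).add (hiT'.norm.const_mul 2)).mono'
      (hYm.mul (ham.norm.pow_const 2)).aestronglyMeasurable (Eventually.of_forall fun ω => ?_)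
    have h1 : a ω = T' ω - T ω := by rw [hT'eq]; ring
    have h2 := norm_sub_le (T' ω) (T ω)
    rw [← h1] at h2
    have h3 : ‖a ω‖ ^ 2 ≤ 2 * ‖T ω‖ ^ 2 + 2 * ‖T' ω‖ ^ 2 := by
      nlinarith [norm_nonneg (a ω), sq_nonneg (‖T ω‖ - ‖T' ω‖)]
    simp only [norm_mul, norm_pow, norm_norm, Pi.add_apply]
    nlinarith [norm_nonneg (Y ω), mul_le_mul_of_nonneg_left h3 (norm_nonneg (Y ω))]
  have hhZ : ∀ ω, R.h i j k ω * Z ω = (Y ω : ℂ) * (a ω * (starRingEnd ℂ) (T ω)) := fun ω => by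
    simp only [hZ, ha]; ring
  have hihZ : Integrable (fun ω => R.h i j k ω * Z ω) μ := by
    refine (hia.norm.add hiT.norm).mono' (hhm.mul hZm).aestronglyMeasurable
      (Eventually.of_forall fun ω => ?_)
    rw [hhZ]
    simp only [norm_mul, norm_pow, norm_norm, Pi.add_apply, RCLike.norm_conj, Complex.norm_real]
    have h3 : ‖a ω‖ * ‖T ω‖ ≤ ‖a ω‖ ^ 2 + ‖T ω‖ ^ 2 := by
      nlinarith [sq_nonneg (‖T ω‖ - ‖a ω‖), sq_nonneg ‖T ω‖, sq_nonneg ‖a ω‖]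
    nlinarith [mul_le_mul_of_nonneg_left h3 (norm_nonneg (Y ω))]
  have hcross : ∫ ω, (R.h i j k ω * Z ω).re ∂μ = 0 := by
    have h1 := (R.indepFun_of_disjoint hdisj hho hZo).integral_fun_mul_eq_mul_integral
      hhm.aestronglyMeasurable hZm.aestronglyMeasurable
    rw [R.integral_h, zero_mul] at h1
    refine (integral_re hihZ).trans ?_
    rw [h1, map_zero]
  have hdiag : ∫ ω, Y ω * ‖a ω‖ ^ 2 ∂μ
      = S.linkWeight i j * ∫ ω, Y ω * S.power (R.state k ω j) ∂μ := by
    set P : Ω → ℝ := fun ω => Y ω * S.power (R.state k ω j) with hP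
    have hPp : Measurable[R.info (AirIndex.past k)] P :=
      hY.mul (S.measurable_power.comp (R.measurable_state_info k j))
    have hPm : Measurable P := hPp.mono (R.info_le _) le_rfl
    -- As `Γ ^ 2 = Γ`, only its mean enters. The expectation then factors twice: fading against all
    -- other inputs, and slot choices against the past.
    have h1 : ∀ ω, Y ω * ‖a ω‖ ^ 2
        = S.ρ * (‖R.h i j k ω‖ ^ 2 * (R.Gam k i j ω * P ω)) := fun ω => by
      simp only [ha, hP, norm_mul, mul_pow, S.norm_signal_sq, Complex.norm_real,
        Real.norm_eq_abs, sq_abs, R.Gam_sq]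
      ring
    have h2 : IndepFun (fun ω => ‖R.h i j k ω‖ ^ 2) (fun ω => R.Gam k i j ω * P ω) μ :=
      R.indepFun_of_disjoint hdisj ((measurable_norm.comp hho).pow_const 2)
        (hGo.mul (hPp.mono (R.info_mono hpast) le_rfl))
    have h3 : IndepFun (R.Gam k i j) P μ := by
      refine R.indepFun_of_disjoint (T := {q | q.time = k})
        (Set.disjoint_left.2 fun q hq hq' => absurd hq (Nat.ne_of_lt hq'))
        (R.measurable_Gam_info rfl rfl) hPp
    simp_rw [h1]
    rw [integral_const_mul, h2.integral_fun_mul_eq_mul_integral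
      (hhm.norm.pow_const 2).aestronglyMeasurable (hGm.mul hPm).aestronglyMeasurable,
      h3.integral_fun_mul_eq_mul_integral hGm.aestronglyMeasurable hPm.aestronglyMeasurable,
      R.integral_norm_h_sq, R.integral_Gam k hij, AirSystem.linkWeight]
    ring
  have hexp : ∀ ω, Y ω * ‖T' ω‖ ^ 2
      = Y ω * ‖a ω‖ ^ 2 + 2 * (R.h i j k ω * Z ω).re + Y ω * ‖T ω‖ ^ 2 := fun ω => by
    rw [hhZ, Complex.re_ofReal_mul, hT'eq, ← Complex.normSq_eq_norm_sq, Complex.normSq_add,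
      Complex.normSq_eq_norm_sq, Complex.normSq_eq_norm_sq]
    ring
  have hire : Integrable (fun ω => 2 * (R.h i j k ω * Z ω).re) μ := hihZ.re.const_mul 2
  have hi2 : Integrable (fun ω => Y ω * ‖a ω‖ ^ 2 + 2 * (R.h i j k ω * Z ω).re) μ := hia.add hire
  refine (integral_congr_ae (Eventually.of_forall hexp)).trans ?_
  rw [integral_add hi2 hiT, integral_add hia hire, integral_const_mul, hcross, hdiag]
  ring

/-- Transmitters are added one at a time, starting from noise alone. The agent itself is excluded,
since `Γ` on the diagonal does not have the mean that `linkWeight` contains. -/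
theorem integral_mul_norm_partialReceived_sq {k : ℕ} {Y : Ω → ℝ}
    (hY : Measurable[R.info (AirIndex.past k)] Y) (hY2 : MemLp Y 2 μ) {i : Fin N}
    {s : Finset (Fin N)} (hs : i ∉ s) :
    ∫ ω, Y ω * ‖R.partialReceived k i s (R.state k ω) ω‖ ^ 2 ∂μ
      = ∑ j ∈ s, S.linkWeight i j * ∫ ω, Y ω * S.power (R.state k ω j) ∂μ
        + (S.σ i : ℝ) ^ 2 * ∫ ω, Y ω ∂μ := by
  induction s using Finset.induction_on with
  | empty =>
    have hind : IndepFun (fun ω => ‖R.n i k ω‖ ^ 2) Y μ := by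
      have hn : Measurable[R.info {q | q.time = k}] (R.n i k) :=
        R.measurable_n_info (Set.mem_ofPred.2 rfl)
      exact R.indepFun_of_disjoint
        (Set.disjoint_left.2 fun q hq hq' => absurd hq (Nat.ne_of_lt hq'))
        ((measurable_norm.comp hn).pow_const 2) hY
    have h := hind.integral_fun_mul_eq_mul_integral
      ((R.n_measurable i k).norm.pow_const 2).aestronglyMeasurable hY2.aestronglyMeasurable
    rw [R.integral_norm_n_sq] at h
    simpa [partialReceived, mul_comm] using h
  | insert j s hj ih =>
    rw [Finset.mem_insert, not_or] at hs
    rw [R.integral_mul_norm_partialReceived_insert_sq hY hY2 hj hs.1, ih hs.2,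
      Finset.sum_insert hj]
    ring

/-- Conditionally on the past, the mean of `drive` is `drift`. -/
theorem integral_mul_drive {k : ℕ} {Y : Ω → ℝ}
    (hY : Measurable[R.info (AirIndex.past k)] Y) (hY2 : MemLp Y 2 μ) (i : Fin N) :
    ∫ ω, Y ω * R.drive k (R.state k ω) i ω ∂μ
      = ∫ ω, Y ω * S.drift k (R.state k ω) i ∂μ := by
  classical
  have hiX : ∀ j, Integrable (fun ω => Y ω * R.state k ω j) μ := fun j =>
    hY2.integrable_mul (R.memLp_state k j)
  have hiP : ∀ j, Integrable (fun ω => Y ω * S.power (R.state k ω j)) μ := fun j =>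
    hY2.integrable_mul (R.memLp_power k j)
  by_cases hf : i ∈ S.failed k
  -- A failed agent is isolated, so its drift vanishes together with its increment.
  · have h1 : ∀ x, S.drift k x i = 0 := fun x => Finset.sum_eq_zero fun j _ => by
      rw [S.abar_of_not_adj (S.not_adj_of_failed k i hf j), zero_mul]
    simp [drive, hf, h1]
  · set s : Finset (Fin N) := {j | (S.graph k).Adj i j} with hs
    have his : i ∉ s := by simp [hs]
    have hrec : ∀ ω, R.received k (R.state k ω) i ω
        = R.partialReceived k i s (R.state k ω) ω := fun ω => by
      unfold received partialReceived
      congr! 2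
    have h1 : ∀ ω, Y ω * R.drive k (R.state k ω) i ω
        = Y ω * ‖R.partialReceived k i s (R.state k ω) ω‖ ^ 2 - (S.σ i : ℝ) ^ 2 * Y ω
          - (∑ j, S.abar k i j) * (Y ω * R.state k ω i) := fun ω => by
      rw [drive, if_neg hf, hrec]; ring
    have h2 : ∀ ω, Y ω * S.drift k (R.state k ω) i
        = ∑ j, S.abar k i j * (Y ω * S.power (R.state k ω j))
          - (∑ j, S.abar k i j) * (Y ω * R.state k ω i) := fun ω => by
      rw [AirSystem.drift, Finset.mul_sum, Finset.sum_mul, ← Finset.sum_sub_distrib]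
      exact Finset.sum_congr rfl fun j _ => by ring
    have hiR : Integrable
        (fun ω => Y ω * ‖R.partialReceived k i s (R.state k ω) ω‖ ^ 2) μ :=
      hY2.integrable_mul (R.memLp_norm_partialReceived_sq k i s)
    have hiY : Integrable (fun ω => (S.σ i : ℝ) ^ 2 * Y ω) μ :=
      (hY2.integrable (by norm_num)).const_mul _
    have hiRY : Integrable (fun ω => Y ω * ‖R.partialReceived k i s (R.state k ω) ω‖ ^ 2
        - (S.σ i : ℝ) ^ 2 * Y ω) μ := hiR.sub hiY
    have hiS : Integrable (fun ω => ∑ j, S.abar k i j * (Y ω * S.power (R.state k ω j))) μ :=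
      integrable_finsetSum _ fun j _ => (hiP j).const_mul _
    -- The noise power in the mean of the received power cancels against the subtracted `σ i ^ 2`.
    simp_rw [h1, h2]
    rw [integral_sub hiRY ((hiX i).const_mul _), integral_sub hiR hiY,
      integral_sub hiS ((hiX i).const_mul _),
      R.integral_mul_norm_partialReceived_sq hY hY2 his, integral_const_mul,
      integral_finsetSum _ fun j _ => (hiP j).const_mul _, add_sub_cancel_right]
    congr 1
    simp_rw [integral_const_mul]
    rw [hs, Finset.sum_filter]
    refine Finset.sum_congr rfl fun j _ => ?_
    split_ifs with h
    · rw [S.abar_of_adj h]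
    · rw [S.abar_of_not_adj h, zero_mul]

end AirRandomness

/-! ### Consequences of the step-size conditions -/

namespace AirSystem

variable {N : ℕ} (S : AirSystem N)

theorem tendsto_step_zero (h : Summable fun k => S.α k ^ 2) : Tendsto S.α atTop (𝓝 0) := by
  have h1 := (Real.continuous_sqrt.tendsto 0).comp h.tendsto_atTop_zero
  rw [Real.sqrt_zero] at h1
  exact h1.congr fun k => Real.sqrt_sq (S.α_pos k).le

theorem exists_eventually_step_le
    (h : limsup (fun k => ((S.α k / S.α (k + 1) : ℝ) : EReal)) atTop < ⊤) :
    ∃ M, ∀ᶠ k in atTop, S.α k ≤ M * S.α (k + 1) := by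
  obtain ⟨M, hM, -⟩ := EReal.lt_iff_exists_real_btwn.1 h
  refine ⟨M, (eventually_lt_of_limsup_lt hM).mono fun k hk => ?_⟩
  rw [EReal.coe_lt_coe_iff, div_lt_iff₀ (S.α_pos _)] at hk
  exact hk.le

end AirSystem

/-! ### Mean-square recursions for the states -/

namespace AirRandomness

variable {N : ℕ} {S : AirSystem N} {Ω : Type*} [mΩ : MeasurableSpace Ω] {μ : Measure Ω}
  (R : AirRandomness S μ)

theorem V_eq (k : ℕ) (ω : Ω) : R.V k ω = ∑ i, deviation (R.state k ω) i ^ 2 := by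
  rw [V, EuclideanSpace.real_norm_sq_eq]
  refine Finset.sum_congr rfl fun i _ => ?_
  congr 1
  rw [Matrix.sub_mulVec, Matrix.one_mulVec, Matrix.smul_mulVec]
  simp [Matrix.mulVec, dotProduct, deviation, div_eq_inv_mul]

theorem measurable_comp_state_info {β : Type*} [MeasurableSpace β] {f : (Fin N → ℝ) → β}
    (hf : Measurable f) (k : ℕ) :
    Measurable[R.info (AirIndex.past k)] fun ω => f (R.state k ω) :=
  hf.comp (@measurable_pi_lambda Ω (Fin N) (fun _ => ℝ) (R.info _) _ _ fun i => R.measurable_state_info k i)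

variable [IsProbabilityMeasure μ]

theorem memLp_drift (k : ℕ) (i : Fin N) :
    MemLp (fun ω => S.drift k (R.state k ω) i) 2 μ :=
  memLp_finsetSum _ fun j _ => ((R.memLp_power k j).sub (R.memLp_state k i)).const_mul _

theorem memLp_deviation (k : ℕ) (i : Fin N) :
    MemLp (fun ω => deviation (R.state k ω) i) 2 μ := by
  unfold deviation
  simp_rw [div_eq_inv_mul]
  exact (R.memLp_state k i).sub ((memLp_finsetSum _ fun j _ => R.memLp_state k j).const_mul _)

theorem memLp_max_neg (k : ℕ) (i : Fin N) :
    MemLp (fun ω => max (-R.state k ω i) 0) 2 μ :=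
  (R.memLp_state k i).of_le
    ((R.measurable_state k i).neg.max measurable_const).aestronglyMeasurable
    (Eventually.of_forall fun ω => by
      rw [Real.norm_eq_abs, Real.norm_eq_abs, abs_of_nonneg (le_max_right _ _)]
      exact max_le (neg_le_abs _) (abs_nonneg _))

/-- The mean change in one step of a function of the states with a quadratic upper bound. -/
theorem integral_step_le {F : (Fin N → ℝ) → ℝ} {Y : (Fin N → ℝ) → Fin N → ℝ}
    (hF : ∀ k, Integrable (fun ω => F (R.state k ω)) μ) (hYm : ∀ i, Measurable fun x => Y x i)
    (hY2 : ∀ k i, MemLp (fun ω => Y (R.state k ω) i) 2 μ)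
    (hle : ∀ x d : Fin N → ℝ, ∀ a : ℝ,
      F (fun i => x i + a * d i) ≤ F x + 2 * a * ∑ i, Y x i * d i + a ^ 2 * ∑ i, d i ^ 2)
    (k : ℕ) :
    ∫ ω, F (R.state (k + 1) ω) ∂μ ≤ ∫ ω, F (R.state k ω) ∂μ
      + 2 * S.α k * ∫ ω, ∑ i, Y (R.state k ω) i * S.drift k (R.state k ω) i ∂μ
      + S.α k ^ 2 * ∫ ω, ∑ i, R.drive k (R.state k ω) i ω ^ 2 ∂μ := by
  have hd := R.memLp_drive (R.memLp_state k)
  have hi1 : ∀ i, Integrable (fun ω => Y (R.state k ω) i * R.drive k (R.state k ω) i ω) μ :=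
    fun i => (hY2 k i).integrable_mul (hd i)
  have hi2 : ∀ i, Integrable (fun ω => Y (R.state k ω) i * S.drift k (R.state k ω) i) μ :=
    fun i => (hY2 k i).integrable_mul (R.memLp_drift k i)
  have h1 : ∫ ω, ∑ i, Y (R.state k ω) i * R.drive k (R.state k ω) i ω ∂μ
      = ∫ ω, ∑ i, Y (R.state k ω) i * S.drift k (R.state k ω) i ∂μ := by
    rw [integral_finsetSum _ fun i _ => hi1 i, integral_finsetSum _ fun i _ => hi2 i]
    exact Finset.sum_congr rfl fun i _ =>
      R.integral_mul_drive (R.measurable_comp_state_info (hYm i) k) (hY2 k i) i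
  have hs1 : Integrable
      (fun ω => 2 * S.α k * ∑ i, Y (R.state k ω) i * R.drive k (R.state k ω) i ω) μ :=
    (integrable_finsetSum _ fun i _ => hi1 i).const_mul _
  have hs2 : Integrable (fun ω => S.α k ^ 2 * ∑ i, R.drive k (R.state k ω) i ω ^ 2) μ :=
    (integrable_finsetSum _ fun i _ => (hd i).integrable_sq).const_mul _
  have hs3 : Integrable (fun ω => F (R.state k ω)
      + 2 * S.α k * ∑ i, Y (R.state k ω) i * R.drive k (R.state k ω) i ω) μ := (hF k).add hs1
  calc ∫ ω, F (R.state (k + 1) ω) ∂μ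
      ≤ ∫ ω, (F (R.state k ω) + 2 * S.α k * ∑ i, Y (R.state k ω) i * R.drive k (R.state k ω) i ω
        + S.α k ^ 2 * ∑ i, R.drive k (R.state k ω) i ω ^ 2) ∂μ := by
        refine integral_mono (hF (k + 1)) (hs3.add hs2) fun ω => ?_
        have h2 : R.state (k + 1) ω
            = fun i => R.state k ω i + S.α k * R.drive k (R.state k ω) i ω :=
          funext fun i => R.state_succ k ω i
        simp only [h2]
        exact hle _ _ _
    _ = _ := by
      rw [integral_add hs3 hs2, integral_add (hF k) hs1, integral_const_mul, integral_const_mul, h1]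

/-- The drift does not increase the mean of `∑ i, x i ^ 2`, so growth comes only from the summable
`α k ^ 2` times one plus that mean: a discrete Grönwall argument. -/
theorem exists_integral_sum_sq_le (hα : Summable fun k => S.α k ^ 2) :
    ∃ B, ∀ k, ∫ ω, ∑ i, R.state k ω i ^ 2 ∂μ ≤ B := by
  obtain ⟨C, hC0, hC⟩ := R.exists_integral_drive_sq_le
  refine bounded_of_summable_growth (a := fun k => N * C * S.α k ^ 2) (fun k => by positivity)
    (hα.mul_left _) (fun k => integral_nonneg fun ω => by positivity) fun k => ?_
  have h := R.integral_step_le (F := fun x => ∑ i, x i ^ 2) (Y := fun x => x)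
    (fun k => R.integrable_sum_sq (R.memLp_state k)) (fun i => measurable_pi_apply i)
    R.memLp_state (fun x d a => le_of_eq ?_) k
  · have h1 : ∫ ω, ∑ i, R.state k ω i * S.drift k (R.state k ω) i ∂μ ≤ 0 :=
      integral_nonpos fun ω => S.sum_mul_drift_nonpos k _
    have h2 : ∫ ω, ∑ i, R.drive k (R.state k ω) i ω ^ 2 ∂μ
        ≤ N * (C * (1 + ∫ ω, ∑ j, R.state k ω j ^ 2 ∂μ)) := by
      rw [integral_finsetSum _ fun i _ => (R.memLp_drive (R.memLp_state k) i).integrable_sq]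
      simpa using Finset.sum_le_card_nsmul Finset.univ _ _ fun i _ => hC k i
    have h3 := mul_nonpos_of_nonneg_of_nonpos (show 0 ≤ 2 * S.α k by linarith [S.α_pos k]) h1
    have h4 := mul_le_mul_of_nonneg_left h2 (sq_nonneg (S.α k))
    linarith
  · simp_rw [Finset.mul_sum, ← Finset.sum_add_distrib]
    exact Finset.sum_congr rfl fun i _ => by ring

theorem exists_integral_sum_drive_sq_le (hα : Summable fun k => S.α k ^ 2) :
    ∃ Q, ∀ k, ∫ ω, ∑ i, R.drive k (R.state k ω) i ω ^ 2 ∂μ ≤ Q := by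
  obtain ⟨C, hC0, hC⟩ := R.exists_integral_drive_sq_le
  obtain ⟨B, hB⟩ := R.exists_integral_sum_sq_le hα
  refine ⟨N * (C * (1 + B)), fun k => ?_⟩
  rw [integral_finsetSum _ fun i _ => (R.memLp_drive (R.memLp_state k) i).integrable_sq]
  have h := hB k
  simpa using Finset.sum_le_card_nsmul Finset.univ _ _ fun i _ => (hC k i).trans
    (show _ ≤ C * (1 + B) by gcongr)

theorem integrable_sum_sub_sq (k l : ℕ) :
    Integrable (fun ω => ∑ i, (R.state l ω i - R.state k ω i) ^ 2) μ :=
  integrable_finsetSum _ fun i _ => ((R.memLp_state l i).sub (R.memLp_state k i)).integrable_sq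

/-- Over a bounded number of steps the states move less and less in mean square. -/
theorem tendsto_integral_sum_sub_sq (hα : Summable fun k => S.α k ^ 2) (t : ℕ) :
    Tendsto (fun k => ∫ ω, ∑ i, (R.state (k + t) ω i - R.state k ω i) ^ 2 ∂μ) atTop (𝓝 0) := by
  obtain ⟨Q, hQ⟩ := R.exists_integral_sum_drive_sq_le hα
  induction t with
  | zero => simp
  | succ t ih =>
    have hlim := (ih.const_mul 2).add
      (((hα.tendsto_atTop_zero.comp (tendsto_add_atTop_nat t)).mul_const Q).const_mul 2)
    simp only [mul_zero, zero_mul, add_zero] at hlim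
    refine squeeze_zero (fun k => integral_nonneg fun ω => by positivity) (fun k => ?_) hlim
    have hd : Integrable
        (fun ω => ∑ i, R.drive (k + t) (R.state (k + t) ω) i ω ^ 2) μ :=
      integrable_finsetSum _ fun i _ =>
        (R.memLp_drive (R.memLp_state (k + t)) i).integrable_sq
    have hi1 := (R.integrable_sum_sub_sq k (k + t)).const_mul 2
    have hi2 := (hd.const_mul (S.α (k + t) ^ 2)).const_mul 2
    have h1 := mul_le_mul_of_nonneg_left (hQ (k + t)) (sq_nonneg (S.α (k + t)))
    calc ∫ ω, ∑ i, (R.state (k + (t + 1)) ω i - R.state k ω i) ^ 2 ∂μ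
        ≤ ∫ ω, (2 * ∑ i, (R.state (k + t) ω i - R.state k ω i) ^ 2
          + 2 * (S.α (k + t) ^ 2 * ∑ i, R.drive (k + t) (R.state (k + t) ω) i ω ^ 2)) ∂μ := by
          refine integral_mono (R.integrable_sum_sub_sq k _) (hi1.add hi2) fun ω => ?_
          simp only [Finset.mul_sum, ← Finset.sum_add_distrib]
          refine Finset.sum_le_sum fun i _ => ?_
          rw [← add_assoc, state_succ]
          nlinarith [sq_nonneg (R.state (k + t) ω i - R.state k ω i
            - S.α (k + t) * R.drive (k + t) (R.state (k + t) ω) i ω)]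
      _ = 2 * ∫ ω, ∑ i, (R.state (k + t) ω i - R.state k ω i) ^ 2 ∂μ
          + 2 * (S.α (k + t) ^ 2 * ∫ ω, ∑ i, R.drive (k + t) (R.state (k + t) ω) i ω ^ 2 ∂μ) := by
          rw [integral_add hi1 hi2, integral_const_mul, integral_const_mul, integral_const_mul]
      _ ≤ _ := by simp only [Function.comp]; linarith

theorem tendsto_window_sub_sq (hα : Summable fun k => S.α k ^ 2) (L : ℕ) (c : ℝ) :
    Tendsto (fun k => ∑ t ∈ Finset.range L,
      c * ∫ ω, ∑ i, (R.state (k + t) ω i - R.state k ω i) ^ 2 ∂μ) atTop (𝓝 0) := by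
  rw [← Finset.sum_const_zero (s := Finset.range L) (M := ℝ)]
  refine tendsto_finsetSum _ fun t _ => ?_
  simpa using (R.tendsto_integral_sum_sub_sq hα t).const_mul c

/-! ### Decay of the negative parts -/

theorem integrable_sum_max_neg_sq (k : ℕ) (w : Fin N → ℝ) :
    Integrable (fun ω => ∑ i, w i * max (-R.state k ω i) 0 ^ 2) μ :=
  integrable_finsetSum _ fun i _ => (R.memLp_max_neg k i).integrable_sq.const_mul _

/-- The negative parts of the states vanish in mean square. -/
theorem tendsto_integral_sum_max_neg_sq (hStep : S.StepSize) (hConn : S.JointlyConnected)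
    (hMono : S.MonotoneStepSize) (hN : 2 ≤ N) :
    Tendsto (fun k => ∫ ω, ∑ i, max (-R.state k ω i) 0 ^ 2 ∂μ) atTop (𝓝 0) := by
  obtain ⟨hsum, hsq, -⟩ := hStep
  obtain ⟨L, hL, hconn⟩ := hConn
  obtain ⟨M, hM⟩ := S.exists_eventually_step_le hMono.2
  obtain ⟨A, hA0, hA⟩ := S.exists_abar_le
  obtain ⟨a, ha, hadj⟩ := S.exists_le_abar
  obtain ⟨Q, hQ⟩ := R.exists_integral_sum_drive_sq_le hsq
  have hα0 := S.tendsto_step_zero hsq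
  have hint : ∀ k, Integrable (fun ω => ∑ i, max (-R.state k ω i) 0 ^ 2) μ := fun k =>
    integrable_finsetSum _ fun i _ => (R.memLp_max_neg k i).integrable_sq
  -- The factor 2 in `e` compensates the one half lost in freezing the state over the window, so `c`
  -- is just the lower bound `a` on the window degrees.
  refine tendsto_zero_of_window_decrease
    (e := fun k => 2 * ∫ ω, ∑ i, (∑ j, S.abar k i j) * max (-R.state k ω i) 0 ^ 2 ∂μ)
    (η := fun k => S.α k * Q)
    (ζ := fun k => ∑ t ∈ Finset.range L,
      2 * (N * A) * ∫ ω, ∑ i, (R.state (k + t) ω i - R.state k ω i) ^ 2 ∂μ) (c := a)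
    S.α_pos (antitone_nat_of_succ_le hMono.1) hα0 hsum hM hL ha
    (fun k => integral_nonneg fun ω => by positivity) (fun k => ?_) ?_
    (R.tendsto_window_sub_sq hsq L _) (fun k => ?_) (fun k => ?_)
  · exact mul_nonneg two_pos.le (integral_nonneg fun ω => Finset.sum_nonneg fun i _ =>
      mul_nonneg (Finset.sum_nonneg fun j _ => S.abar_nonneg k i j) (sq_nonneg _))
  · simpa using hα0.mul_const Q
  · have h := R.integral_step_le (F := fun x => ∑ i, max (-x i) 0 ^ 2)
      (Y := fun x i => -max (-x i) 0) hint
      (fun i => ((measurable_pi_apply i).neg.max measurable_const).neg)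
      (fun k i => (R.memLp_max_neg k i).neg) (fun x d s => ?_) k
    · have h1 : ∫ ω, ∑ i, -max (-R.state k ω i) 0 * S.drift k (R.state k ω) i ∂μ
          ≤ -∫ ω, ∑ i, (∑ j, S.abar k i j) * max (-R.state k ω i) 0 ^ 2 ∂μ := by
        rw [← integral_neg]
        refine integral_mono (integrable_finsetSum _ fun i _ =>
          (R.memLp_max_neg k i).neg.integrable_mul (R.memLp_drift k i))
          (R.integrable_sum_max_neg_sq k _).neg fun ω => ?_
        simp only [← Finset.sum_neg_distrib]
        refine Finset.sum_le_sum fun i _ => ?_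
        rw [neg_mul]
        exact S.neg_max_neg_mul_drift_le k _ i
      have h2 := mul_le_mul_of_nonneg_left h1 (show 0 ≤ 2 * S.α k by linarith [S.α_pos k])
      have h3 := mul_le_mul_of_nonneg_left (hQ k) (sq_nonneg (S.α k))
      linarith
    · simp_rw [Finset.mul_sum, ← Finset.sum_add_distrib]
      refine Finset.sum_le_sum fun i _ => (max_neg_add_sq_le (x i) (s * d i)).trans_eq ?_
      ring
  · have h1 : ∀ t, ∫ ω, ∑ i, (∑ j, S.abar (k + t) i j) * max (-R.state k ω i) 0 ^ 2 ∂μ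
          - 2 * (N * A) * ∫ ω, ∑ i, (R.state (k + t) ω i - R.state k ω i) ^ 2 ∂μ
        ≤ 2 * ∫ ω, ∑ i, (∑ j, S.abar (k + t) i j) * max (-R.state (k + t) ω i) 0 ^ 2 ∂μ := by
      intro t
      rw [← integral_const_mul, ← integral_const_mul, ← integral_sub
        (R.integrable_sum_max_neg_sq k _) ((R.integrable_sum_sub_sq k (k + t)).const_mul _)]
      refine integral_mono ((R.integrable_sum_max_neg_sq k _).sub
        ((R.integrable_sum_sub_sq k (k + t)).const_mul _))
        ((R.integrable_sum_max_neg_sq (k + t) _).const_mul 2) fun ω => ?_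
      simp only [Finset.mul_sum, ← Finset.sum_sub_distrib]
      refine Finset.sum_le_sum fun i _ => ?_
      have h2 := half_max_neg_sq_le (R.state k ω i) (R.state (k + t) ω i)
      have h3 : 0 ≤ ∑ j, S.abar (k + t) i j :=
        Finset.sum_nonneg fun j _ => S.abar_nonneg _ i j
      have h4 : ∑ j, S.abar (k + t) i j ≤ N * A := by
        simpa using Finset.sum_le_card_nsmul Finset.univ _ A fun j _ => hA (k + t) i j
      have h5 := mul_le_mul_of_nonneg_left h2 h3
      have h6 := mul_le_mul_of_nonneg_right h4
        (sq_nonneg (R.state (k + t) ω i - R.state k ω i))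
      linarith
    have h2 := Finset.sum_le_sum fun t (_ : t ∈ Finset.range L) => h1 t
    rw [Finset.sum_sub_distrib] at h2
    refine le_trans (sub_le_sub_right ?_ _) h2
    rw [← integral_finsetSum _ fun t _ => R.integrable_sum_max_neg_sq k _, ← integral_const_mul]
    refine integral_mono ((hint k).const_mul a)
      (integrable_finsetSum _ fun t _ => R.integrable_sum_max_neg_sq k _) fun ω => ?_
    simp only [Finset.mul_sum]
    rw [Finset.sum_comm]
    refine Finset.sum_le_sum fun i _ => ?_
    rw [← Finset.sum_mul]
    exact mul_le_mul_of_nonneg_right (S.window_degree_ge hN hadj (hconn k) i) (sq_nonneg _)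

/-! ### Decay of the disagreement -/

theorem integrable_quadratic_form (k : ℕ) (w : Fin N → Fin N → ℝ) :
    Integrable (fun ω => ∑ i, ∑ j, w i j * (R.state k ω i - R.state k ω j) ^ 2) μ :=
  integrable_finsetSum _ fun i _ => integrable_finsetSum _ fun j _ =>
    (((R.memLp_state k i).sub (R.memLp_state k j)).integrable_sq).const_mul _

theorem integrable_sum_deviation_sq (k : ℕ) :
    Integrable (fun ω => ∑ i, deviation (R.state k ω) i ^ 2) μ :=
  integrable_finsetSum _ fun i _ => (R.memLp_deviation k i).integrable_sq

theorem tendsto_integral_sum_deviation_sq (hStep : S.StepSize) (hConn : S.JointlyConnected)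
    (hMono : S.MonotoneStepSize) (hN : 2 ≤ N) :
    Tendsto (fun k => ∫ ω, ∑ i, deviation (R.state k ω) i ^ 2 ∂μ) atTop (𝓝 0) := by
  have hneg := R.tendsto_integral_sum_max_neg_sq hStep hConn hMono hN
  obtain ⟨hsum, hsq, -⟩ := hStep
  obtain ⟨L, hL, hconn⟩ := hConn
  obtain ⟨M, hM⟩ := S.exists_eventually_step_le hMono.2
  obtain ⟨A, hA0, hA⟩ := S.exists_abar_le
  obtain ⟨a, ha, hadj⟩ := S.exists_le_abar
  obtain ⟨Q, hQ⟩ := R.exists_integral_sum_drive_sq_le hsq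
  obtain ⟨B, hB⟩ := R.exists_integral_sum_sq_le hsq
  have hα0 := S.tendsto_step_zero hsq
  have hNpos : (0 : ℝ) < N := by exact_mod_cast (by omega : 0 < N)
  set b : ℕ → ℝ := fun k => ∫ ω, ∑ i, max (-R.state k ω i) 0 ^ 2 ∂μ with hb
  have hb0 : ∀ k, 0 ≤ b k := fun k => integral_nonneg fun ω => by positivity
  have hbint : ∀ k, Integrable (fun ω => ∑ i, max (-R.state k ω i) 0 ^ 2) μ := fun k =>
    integrable_finsetSum _ fun i _ => (R.memLp_max_neg k i).integrable_sq
  -- The Young parameter balances both error terms: the square root gives `b k / ε k ≤ ε k`, and the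
  -- second summand keeps `ε k` positive even where `b k` is zero.
  set ε : ℕ → ℝ := fun k => √(b k) + 1 / ((k : ℝ) + 1) with hε
  have hεpos : ∀ k, 0 < ε k := fun k => by positivity
  have hε0 : Tendsto ε atTop (𝓝 0) := by
    have h1 := (Real.continuous_sqrt.tendsto 0).comp hneg
    rw [Real.sqrt_zero] at h1
    simpa [hε] using h1.add tendsto_one_div_add_atTop_nhds_zero_nat
  have hbε : ∀ k, b k / ε k ≤ ε k := fun k => by
    rw [div_le_iff₀ (hεpos k)]
    have h1 : √(b k) ≤ ε k := le_add_of_nonneg_right (by positivity)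
    calc b k = √(b k) * √(b k) := (Real.mul_self_sqrt (hb0 k)).symm
      _ ≤ ε k * ε k := mul_self_le_mul_self (Real.sqrt_nonneg _) h1
  have hvB : ∀ k, ∫ ω, ∑ i, deviation (R.state k ω) i ^ 2 ∂μ ≤ B := fun k =>
    (integral_mono (R.integrable_sum_deviation_sq k) (R.integrable_sum_sq (R.memLp_state k))
      fun ω => sum_deviation_sq_le _).trans (hB k)
  -- In `c`, the factor `a / N ^ 3` is the Poincaré constant and the one half comes from freezing
  -- the state at the start of the window.
  refine tendsto_zero_of_window_decrease
    (e := fun k => ∫ ω, ∑ i, ∑ j, S.abar k i j * (R.state k ω i - R.state k ω j) ^ 2 ∂μ)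
    (η := fun k => 2 * A * N * (ε k * B + ε k) + S.α k * Q)
    (ζ := fun k => ∑ t ∈ Finset.range L,
      4 * N * A * ∫ ω, ∑ i, (R.state (k + t) ω i - R.state k ω i) ^ 2 ∂μ) (c := a / N ^ 3 / 2)
    S.α_pos (antitone_nat_of_succ_le hMono.1) hα0 hsum hM hL (by positivity)
    (fun k => integral_nonneg fun ω => by positivity) (fun k => ?_) ?_
    (R.tendsto_window_sub_sq hsq L _) (fun k => ?_) (fun k => ?_)
  · exact integral_nonneg fun ω => Finset.sum_nonneg fun i _ => Finset.sum_nonneg fun j _ =>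
      mul_nonneg (S.abar_nonneg k i j) (sq_nonneg _)
  · simpa using (((hε0.mul_const B).add hε0).const_mul (2 * A * N)).add (hα0.mul_const Q)
  · have h := R.integral_step_le (F := fun x => ∑ i, deviation x i ^ 2) (Y := deviation)
      R.integrable_sum_deviation_sq (fun i => by unfold deviation; fun_prop)
      R.memLp_deviation sum_deviation_add_smul_sq_le k
    have hi1 := (R.integrable_quadratic_form k (S.abar k)).neg
    have hi2 := (R.integrable_sum_deviation_sq k).const_mul (ε k)
    have hi3 := (hbint k).div_const (ε k)
    have hi4 := (hi2.add hi3).const_mul (2 * A * N)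
    have h1 : 2 * ∫ ω, ∑ i, deviation (R.state k ω) i * S.drift k (R.state k ω) i ∂μ
        ≤ -∫ ω, ∑ i, ∑ j, S.abar k i j * (R.state k ω i - R.state k ω j) ^ 2 ∂μ
          + 2 * A * N * (ε k * ∫ ω, ∑ i, deviation (R.state k ω) i ^ 2 ∂μ + b k / ε k) := by
      rw [← integral_const_mul]
      refine (integral_mono ((integrable_finsetSum _ fun i _ =>
        (R.memLp_deviation k i).integrable_mul (R.memLp_drift k i)).const_mul 2)
        (hi1.add hi4) fun ω => S.sum_deviation_mul_drift_le hA k _ (hεpos k)).trans_eq ?_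
      rw [integral_add' hi1 hi4, integral_const_mul, integral_add' hi2 hi3, integral_const_mul,
        integral_div]
      congr 1
      exact integral_neg _
    have h2 : 2 * A * N * (ε k * ∫ ω, ∑ i, deviation (R.state k ω) i ^ 2 ∂μ + b k / ε k)
        ≤ 2 * A * N * (ε k * B + ε k) := by
      have := hbε k
      have := hvB k
      have := hεpos k
      gcongr
    have h3 := mul_le_mul_of_nonneg_left (h1.trans (add_le_add_right h2 _)) (S.α_pos k).le
    have h4 := mul_le_mul_of_nonneg_left (hQ k) (sq_nonneg (S.α k))
    linarith
  · have h1 : ∀ t, (∫ ω, ∑ i, ∑ j, S.abar (k + t) i j * (R.state k ω i - R.state k ω j) ^ 2 ∂μ) / 2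
          - 4 * N * A * ∫ ω, ∑ i, (R.state (k + t) ω i - R.state k ω i) ^ 2 ∂μ
        ≤ ∫ ω, ∑ i, ∑ j,
          S.abar (k + t) i j * (R.state (k + t) ω i - R.state (k + t) ω j) ^ 2 ∂μ := by
      intro t
      have hi1 := (R.integrable_quadratic_form k (S.abar (k + t))).div_const 2
      have hi2 := (R.integrable_sum_sub_sq k (k + t)).const_mul (4 * N * A)
      rw [← integral_const_mul, ← integral_div, ← integral_sub hi1 hi2]
      exact integral_mono (hi1.sub hi2) (R.integrable_quadratic_form (k + t) _) fun ω =>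
        half_quadratic_form_le (S.abar_nonneg (k + t)) (hA (k + t)) _ _
    have h2 := Finset.sum_le_sum fun t (_ : t ∈ Finset.range L) => h1 t
    rw [Finset.sum_sub_distrib, ← Finset.sum_div] at h2
    refine le_trans (sub_le_sub_right ?_ _) h2
    rw [← integral_finsetSum _ fun t _ => R.integrable_quadratic_form k _, div_mul_eq_mul_div]
    refine div_le_div_of_nonneg_right ?_ two_pos.le
    rw [← integral_const_mul]
    exact integral_mono ((R.integrable_sum_deviation_sq k).const_mul _)
      (integrable_finsetSum _ fun t _ => R.integrable_quadratic_form k _) fun ω =>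
      S.window_deviation_le ha hadj (hconn k) _

end AirRandomness

theorem mainTheorem7 {N : ℕ} (S : AirSystem N) {Ω : Type*} [MeasurableSpace Ω]
    (μ : Measure Ω) [IsProbabilityMeasure μ] (R : AirRandomness S μ)
    (hStep : S.StepSize) (hConn : S.JointlyConnected) (hMono : S.MonotoneStepSize) :
    (∀ k, Integrable (R.V k) μ) ∧ Tendsto (fun k => ∫ ω, R.V k ω ∂μ) atTop (𝓝 0) := by
  have hV : ∀ k, R.V k = fun ω => ∑ i, deviation (R.state k ω) i ^ 2 := fun k =>
    funext (R.V_eq k)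
  simp_rw [hV]
  refine ⟨R.integrable_sum_deviation_sq, ?_⟩
  -- With fewer than two agents every deviation is zero; the degree bound behind the decay of
  -- negative parts would fail for a single agent.
  rcases Nat.lt_or_ge N 2 with hN | hN
  · have h : ∀ (x : Fin N → ℝ) (i : Fin N), deviation x i = 0 := fun x i => by
      have : Subsingleton (Fin N) := Fin.subsingleton_iff_le_one.2 (by omega)
      exact abs_nonpos_iff.1 (abs_deviation_le
        (fun i j => by rw [Subsingleton.elim i j, sub_self, abs_zero]) i)
    simp [h]
  · exact R.tendsto_integral_sum_deviation_sq hStep hConn hMono hN
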